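/- A SAS$^+$ instance is a tuple $\langle V,D,A,I,G\rangle$ where $V$ is a finite set of variables, $D$ a finite domain, $A$ a finite set of actions, $I\in D^V$ the initial state and $G\in (D\cup\{\mathbf u\})^V$ the goal, with $\mathbf u\notin D$ an "undefined" value; each action $a\in A$ has a precondition $\mathrm{pre}(a)$ and an effect $\mathrm{eff}(a)$ in $(D\cup\{\mathbf u\})^V$. An action $a$ is valid in a state $s\in D^V$ if for every $v\in V$ either $\mathrm{pre}(a)[v]=s[v]$ or $\mathrm{pre}(a)[v]=\mathbf u$; its result in $s$ is the state $t$ with $t[v]=\mathrm{eff}(a)[v]$ if $\mathrm{eff}(a)[v]\ne\mathbf u$ and $t[v]=s[v]$ otherwise. A plan is a finite sequence of actions that can be applied successively from $I$, each action being valid in the state in which it is applied, and that ends in a state $s$ such that for every $v\in V$ either $G[v]=s[v]$ or $G[v]=\mathbf u$. Bounded SAS$^+$ Planning is the parameterized problem whose instances are pairs $\langle \Pi,k\rangle$ of a SAS$^+$ instance $\Pi$ and a positive integer $k$, with parameter $k$; the question is whether $\Pi$ has a plan of length at most $k$. A parameterized reduction from a problem $L$ to a problem $L'$ is a map $R$ from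 instances of $L$ to instances of $L'$ such that (1) $\langle x,k\rangle$ is a yes-instance of $L$ if and only if $\langle x',k'\rangle=R(x,k)$ is a yes-instance of $L'$; (2) $k'\le g(k)$ for a computable function $g$; (3) $R$ can be computed in time $O(f(k)\cdot n^c)$ for a computable function $f$ and a constant $c$, where $n$ is the size of $\langle x,k\rangle$. The class $\mathrm{W}[2]$ consists of all parameterized problems that have a parameterized reduction to Weighted 2-Normalized Satisfiability: given a conjunction of disjunctions of literals and a positive integer $k$ (the parameter), is there a satisfying truth assignment that makes exactly $k$ of the variables true? **Theorem.** Bounded SAS$^+$ Planning is in $\mathrm{W}[2]$. -/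

import Mathlib

/-! ## Words -/

/-- The self-delimiting binary code of a finite sequence of natural numbers:
each number `n` is written as `n` ones followed by a zero. -/
def natsToWord (l : List ℕ) : List Bool :=
  l.flatMap fun n => List.replicate n true ++ [false]

theorem natsToWord_injective : Function.Injective natsToWord := by
  have key : ∀ (m n : ℕ) (u w : List Bool),
      List.replicate m true ++ (false :: u) = List.replicate n true ++ (false :: w) →
        m = n ∧ u = w := by
    intro m
    induction m with
    | zero =>
      intro n u w h
      cases n with
      | zero => simpa using h
      | succ n => simp [List.replicate_succ] at h
    | succ m ih =>
      intro n u w h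
      cases n with
      | zero => simp [List.replicate_succ] at h
      | succ n =>
        simp only [List.replicate_succ, List.cons_append, List.cons.injEq, true_and] at h
        obtain ⟨h1, h2⟩ := ih n u w h
        exact ⟨by rw [h1], h2⟩
  intro l
  induction l with
  | nil =>
    intro l' h
    cases l' with
    | nil => rfl
    | cons b l' => simp [natsToWord] at h
  | cons a l ih =>
    intro l' h
    cases l' with
    | nil => simp [natsToWord] at h
    | cons b l' =>
      simp only [natsToWord, List.flatMap_cons, List.append_assoc, List.singleton_append] at h
      obtain ⟨h1, h2⟩ := key _ _ _ _ h
      rw [h1, ih h2]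

/-! ## Parameterized problems and parameterized reductions -/

/-- A parameterized decision problem: instances, written as binary words by an injective encoding
(the word encodes the main part together with the parameter), the parameter of each instance,
and the set of yes-instances. -/
structure ParamProblem where
  Inst : Type
  encode : Inst → List Bool
  encode_injective : Function.Injective encode
  param : Inst → ℕ
  yes : Set Inst

namespace ParamProblem

/-- The size of an instance (including its parameter): the length of its encoding. -/
def size (P : ParamProblem) (x : P.Inst) : ℕ := (P.encode x).length

/-- `R` is computed by a (multi-stack) Turing machine that halts on each instance `x`, with the
encoding of `R x` as its output, after at most `f (param x) * (size x + 1) ^ c` steps, for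
a computable function `f` and a constant `c`. (The constant of the `O` is absorbed in `f`; the `+ 1`
only matters for an instance encoded by the empty word.) -/
def FPTComputable (P Q : ParamProblem) (R : P.Inst → Q.Inst) : Prop :=
  ∃ (M : Turing.TM2ComputableAux Bool Bool) (f : ℕ → ℕ) (c : ℕ), Computable f ∧
    ∀ x : P.Inst, Nonempty (Turing.TM2OutputsInTime M.tm
      ((P.encode x).map M.inputAlphabet.symm)
      (some ((Q.encode (R x)).map M.outputAlphabet.symm))
      (f (P.param x) * (P.size x + 1) ^ c))

/-- `P` reduces to `Q` by a parameterized reduction. -/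
def Reduces (P Q : ParamProblem) : Prop :=
  ∃ R : P.Inst → Q.Inst,
    (∀ x, x ∈ P.yes ↔ R x ∈ Q.yes) ∧
    (∃ g : ℕ → ℕ, Computable g ∧ ∀ x, Q.param (R x) ≤ g (P.param x)) ∧
    FPTComputable P Q R

end ParamProblem

/-! ## Weighted 2-normalized satisfiability and the class W[2] -/

/-- Propositional variables are natural numbers; `(true, v)` is the literal `v` and `(false, v)`
is the literal `¬ v`. -/
abbrev Literal := Bool × ℕ

/-- A 2-normalized Boolean formula: a product (conjunction) of sums (disjunctions) of literals. -/
abbrev TwoNormalized := List (List Literal)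

namespace TwoNormalized

/-- The variables that occur in a formula. -/
def vars (φ : TwoNormalized) : Finset ℕ := (φ.flatten.map Prod.snd).toFinset

/-- The formula holds under the truth assignment in which exactly the variables in `S` are true. -/
def Holds (φ : TwoNormalized) (S : Finset ℕ) : Prop :=
  ∀ C ∈ φ, ∃ l ∈ C, (l.2 ∈ S ↔ l.1 = true)

/-- A literal as a positive number: `¬ v` is `2 v + 1` and `v` is `2 v + 2`. -/
def litCode (l : Literal) : ℕ := 2 * l.2 + 1 + l.1.toNat

/-- A formula as a sequence of numbers: each clause is the list of its literals, ended by `0`. -/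
def code (φ : TwoNormalized) : List ℕ :=
  φ.flatMap fun C => C.map litCode ++ [0]

theorem litCode_injective : Function.Injective litCode := by
  rintro ⟨a, v⟩ ⟨b, w⟩ h
  cases a <;> cases b <;> simp [litCode] at h ⊢ <;> omega

theorem code_injective : Function.Injective code := by
  have key : ∀ (C C' : List Literal) (u w : List ℕ),
      C.map litCode ++ (0 :: u) = C'.map litCode ++ (0 :: w) → C = C' ∧ u = w := by
    intro C
    induction C with
    | nil =>
      intro C' u w h
      cases C' with
      | nil => simpa using h
      | cons l C' =>
        simp [litCode] at h
        omega
    | cons l C ih =>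
      intro C' u w h
      cases C' with
      | nil => simp [litCode] at h
      | cons l' C' =>
        simp only [List.map_cons, List.cons_append, List.cons.injEq] at h
        obtain ⟨h1, h2⟩ := ih C' u w h.2
        exact ⟨by rw [litCode_injective h.1, h1], h2⟩
  intro φ
  induction φ with
  | nil =>
    intro ψ h
    cases ψ with
    | nil => rfl
    | cons C ψ => simp [code] at h
  | cons C φ ih =>
    intro ψ h
    cases ψ with
    | nil => simp [code] at h
    | cons C' ψ =>
      simp only [code, List.flatMap_cons, List.append_assoc, List.singleton_append] at h
      obtain ⟨h1, h2⟩ := key _ _ _ _ h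
      rw [h1, ih h2]

end TwoNormalized

/-- Weighted 2-Normalized Satisfiability. Instance: a 2-normalized formula and a positive
integer `k`. Parameter: `k`. Question: is there a satisfying truth assignment of weight `k`, that
is, one that makes exactly `k` of the variables of the formula true? -/
def weightedTwoNormalizedSat : ParamProblem where
  Inst := TwoNormalized × ℕ+
  encode x := natsToWord ((x.2 : ℕ) :: x.1.code)
  encode_injective := by
    rintro ⟨φ, k⟩ ⟨ψ, l⟩ h
    have h' := natsToWord_injective h
    simp only [List.cons.injEq] at h'
    rw [TwoNormalized.code_injective h'.2, PNat.coe_injective h'.1]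
  param x := (x.2 : ℕ)
  yes := {x | ∃ S : Finset ℕ, S ⊆ x.1.vars ∧ S.card = (x.2 : ℕ) ∧ x.1.Holds S}

/-- The class W[2] of all parameterized problems that have a parameterized reduction to
Weighted 2-Normalized Satisfiability. -/
def W2 : Set ParamProblem := {P | P.Reduces weightedTwoNormalizedSat}

/-! ## SAS+ planning -/

/-- A SAS+ instance with variables `V`, domain `D` and actions `A`. Total states are the functions
`V → D`, partial states the functions `V → Option D`, where `none` is the undefined value. -/
structure SASInstance (V D A : Type) where
  init : V → D
  goal : V → Option D
  pre : A → V → Option D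
  eff : A → V → Option D

namespace SASInstance

variable {V D A : Type}

/-- The action `a` is valid in the state `s`. -/
def Valid (P : SASInstance V D A) (a : A) (s : V → D) : Prop :=
  ∀ v, P.pre a v = some (s v) ∨ P.pre a v = none

/-- The result of the action `a` in the state `s`. -/
def result (P : SASInstance V D A) (a : A) (s : V → D) : V → D :=
  fun v => (P.eff a v).getD (s v)

/-- The action sequence is a plan from the state `s` to the state `t`. -/
def IsPlanFromTo (P : SASInstance V D A) : List A → (V → D) → (V → D) → Prop
  | [], s, t => s = t
  | a :: as, s, t => P.Valid a s ∧ P.IsPlanFromTo as (P.result a s) t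

/-- `s` is a goal state. -/
def IsGoalState (P : SASInstance V D A) (s : V → D) : Prop :=
  ∀ v, P.goal v = some (s v) ∨ P.goal v = none

/-- The action sequence is a plan for the instance. -/
def IsPlan (P : SASInstance V D A) (p : List A) : Prop :=
  ∃ s, P.IsGoalState s ∧ P.IsPlanFromTo p P.init s

end SASInstance

/-- An instance of Bounded SAS+ Planning: a SAS+ instance with finitely many variables, domain
values and actions, and a positive integer `k`. -/
structure BoundedSASInstance where
  numVars : ℕ
  numVals : ℕ
  numActs : ℕ
  plan : SASInstance (Fin numVars) (Fin numVals) (Fin numActs)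
  k : ℕ+

namespace BoundedSASInstance

/-- A value of `D ∪ {undefined}` as a number: undefined is `0` and the value `x` is `x + 1`. -/
def valCode {d : ℕ} : Option (Fin d) → ℕ
  | none => 0
  | some x => (x : ℕ) + 1

/-- The instance as a sequence of numbers: `k`, the numbers of variables, values and actions,
the vectors of the initial state and of the goal, and, for each action, the vectors of its
precondition and of its effect. -/
def code (I : BoundedSASInstance) : List ℕ :=
  (I.k : ℕ) :: I.numVars :: I.numVals :: I.numActs ::
    (List.ofFn (fun v => valCode (some (I.plan.init v))) ++
      (List.ofFn (fun v => valCode (I.plan.goal v)) ++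
        (List.finRange I.numActs).flatMap fun a =>
          List.ofFn (fun v => valCode (I.plan.pre a v)) ++
            List.ofFn (fun v => valCode (I.plan.eff a v))))

theorem valCode_injective {d : ℕ} : Function.Injective (valCode (d := d)) := by
  intro x y h
  cases x <;> cases y <;> simp_all [valCode, Fin.ext_iff]

theorem code_injective : Function.Injective code := by
  have key : ∀ {α : Type} (l : List α) (f g : α → List ℕ),
      (∀ a, (f a).length = (g a).length) → l.flatMap f = l.flatMap g →
        ∀ a ∈ l, f a = g a := by
    intro α l f g hlen
    induction l with
    | nil => simp
    | cons b l ih =>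
      intro h
      rw [List.flatMap_cons, List.flatMap_cons] at h
      obtain ⟨h1, h2⟩ := List.append_inj h (hlen b)
      intro a ha
      rcases List.mem_cons.1 ha with rfl | ha
      · exact h1
      · exact ih h2 a ha
  rintro ⟨n, d, m, ⟨i, g, p, e⟩, k⟩ ⟨n', d', m', ⟨i', g', p', e'⟩, k'⟩ h
  simp only [code, List.cons.injEq] at h
  obtain ⟨hk, rfl, rfl, rfl, h⟩ := h
  obtain ⟨h1, h⟩ := List.append_inj h (by simp)
  obtain ⟨h2, h3⟩ := List.append_inj h (by simp)
  have h3' := key _ _ _ (by simp) h3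
  have hi : i = i' := by
    funext v
    have := congrFun (List.ofFn_injective h1) v
    exact Option.some_injective _ (valCode_injective this)
  have hg : g = g' := by
    funext v
    exact valCode_injective (congrFun (List.ofFn_injective h2) v)
  have hpe : ∀ a, p a = p' a ∧ e a = e' a := by
    intro a
    obtain ⟨h4, h5⟩ := List.append_inj (h3' a (List.mem_finRange a)) (by simp)
    exact ⟨funext fun v => valCode_injective (congrFun (List.ofFn_injective h4) v),
      funext fun v => valCode_injective (congrFun (List.ofFn_injective h5) v)⟩
  have hp : p = p' := funext fun a => (hpe a).1
  have he : e = e' := funext fun a => (hpe a).2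
  rw [hi, hg, hp, he, PNat.coe_injective hk]

end BoundedSASInstance

/-- Bounded SAS+ Planning. Instance: a SAS+ instance and a positive integer `k`. Parameter: `k`.
Question: does the SAS+ instance have a plan of length at most `k`? -/
def boundedSASPlanning : ParamProblem where
  Inst := BoundedSASInstance
  encode I := natsToWord I.code
  encode_injective := natsToWord_injective.comp BoundedSASInstance.code_injective
  param I := (I.k : ℕ)
  yes := {I | ∃ p : List (Fin I.numActs), p.length ≤ (I.k : ℕ) ∧ I.plan.IsPlan p}

/-! Add two actions to the instance: `0`, with precondition and effect equal to the initial state,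
and `1`, with precondition and effect equal to the goal. Wherever they are valid they change
nothing. So a plan of length at most `k` exists exactly when there is an executable sequence of
exactly `T = k + 2` actions that begins with `0` and ends with `1`: a short plan is padded at its
end with copies of `1`, and conversely all occurrences of `0` and `1` can be deleted
(`SASInstance.exists_plan_iff`).

With `M` actions in all, the variable `i * M + a` says that `a` takes place at time `i`. One clause
per time asks for some action. These `T` clauses use disjoint blocks of variables, so weight `T`
leaves exactly one action per time, and the satisfying assignments correspond to sequences of
actions (`satisfiable_planFormula`).

Executability has to be said by clauses without intermediate states. If `a` at time `i` requires the
value `d` of `v`, and `b` at time `j < i` sets `v`, then some action at a time in `[j, i)` must set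
`v` to `d`. Since `0` at time `0` sets every variable, there is a last time before `i` at which `v`
is set; the clause for that `j` leaves only `j` itself, so the current value is `d`. Conversely, the
last setting of `v` witnesses all the clauses for earlier `j` (`lastValue_eq_iff`). If `b` itself
sets `d`, the clause is a tautology. Each support clause is a single disjunction, so the formula is
2-normalized; its size is polynomial and the new parameter is `k + 2`.

The running time is proved for an actual machine. A small language with unary registers and bounded
loops (`Cmd`) is compiled to stack programs, and these to `TM2` machines. As numbers are written in
unary, every number read is at most the input length, so nested loops over such numbers cost
polynomial time (`bound_poly`, `exists_machine`). -/

/-! ## A language of stack programs and its compilation to stack machines -/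

/-- Programs over stacks of Booleans. `drain k` empties `k`; `move k k'` pours `k` onto `k'`;
`shift k k₁ k₂` transfers the leading unary number of `k`, with its terminator, to `k₁`, and adds it
to `k₂`; `loop k p` pops `k` and runs `p` as long as the popped symbol is `true`. -/
inductive StackProg (K : Type) where
  | push (k : K) (b : Bool)
  | pop (k : K)
  | drain (k : K)
  | move (k k' : K)
  | shift (k k₁ k₂ : K)
  | loop (k : K) (p : StackProg K)
  | seq (p q : StackProg K)

namespace StackProg

open Function Turing

variable {K : Type}

/-- The labels of the machine code of a program. -/
def Label : StackProg K → Type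
  | push _ _ => Unit
  | pop _ => Unit
  | drain _ => Unit
  | move _ _ => Unit
  | shift _ _ _ => Unit
  | loop _ p => Option p.Label
  | seq p q => p.Label ⊕ q.Label

instance instFintypeLabel : (p : StackProg K) → Fintype p.Label
  | push _ _ => inferInstanceAs (Fintype Unit)
  | pop _ => inferInstanceAs (Fintype Unit)
  | drain _ => inferInstanceAs (Fintype Unit)
  | move _ _ => inferInstanceAs (Fintype Unit)
  | shift _ _ _ => inferInstanceAs (Fintype Unit)
  | loop _ p => letI := instFintypeLabel p; inferInstanceAs (Fintype (Option p.Label))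
  | seq p q =>
    letI := instFintypeLabel p
    letI := instFintypeLabel q
    inferInstanceAs (Fintype (p.Label ⊕ q.Label))

/-- The label at which a program starts. -/
def start : (p : StackProg K) → p.Label
  | push _ _ => ()
  | pop _ => ()
  | drain _ => ()
  | move _ _ => ()
  | shift _ _ _ => ()
  | loop _ _ => none
  | seq p _ => Sum.inl p.start

/-- Statements of a machine all of whose stacks hold Booleans, and that remembers the symbol popped
last. -/
abbrev MStmt (K Λ : Type) := TM2.Stmt (fun _ : K => Bool) Λ (Option Bool)

/-- Configurations of such a machine. -/
abbrev MCfg (K Λ : Type) := TM2.Cfg (fun _ : K => Bool) Λ (Option Bool)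

/-- The machine code of a program, with its labels embedded by `e`, that continues at `x`. -/
def code {Λ : Type} : (p : StackProg K) → (p.Label → Λ) → Λ → p.Label → MStmt K Λ
  | push k b, _, x, _ => .push k (fun _ => b) (.goto fun _ => x)
  | pop k, _, x, _ => .pop k (fun _ o => o) (.goto fun _ => x)
  | drain k, e, x, _ => .pop k (fun _ o => o) (.goto fun v => if v.isSome then e () else x)
  | move k k', e, x, _ =>
    .pop k (fun _ o => o) (.branch (fun v => v.isSome)
      (.push k' (fun v => v.getD false) (.goto fun _ => e ())) (.goto fun _ => x))
  | shift k k₁ k₂, e, x, _ =>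
    .pop k (fun _ o => o) (.branch (fun v => v.isSome)
      (.push k₁ (fun v => v.getD false) (.branch (fun v => v.getD false)
        (.push k₂ (fun _ => true) (.goto fun _ => e ())) (.goto fun _ => x)))
      (.goto fun _ => x))
  | loop _ p, e, _, some l => p.code (fun l => e (some l)) (e none) l
  | loop k p, e, x, none =>
    .pop k (fun _ o => o) (.goto fun v => if v = some true then e (some p.start) else x)
  | seq p q, e, _, .inl l => p.code (fun l => e (.inl l)) (e (.inr q.start)) l
  | seq _ q, e, x, .inr l => q.code (fun l => e (.inr l)) x l

variable [DecidableEq K]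

/-- The effect of `shift`, by recursion on the content of the first stack. -/
def shiftRun (k k₁ k₂ : K) : List Bool → (K → List Bool) → K → List Bool
  | [], S => update S k []
  | false :: w, S => update (update S k w) k₁ (false :: S k₁)
  | true :: w, S =>
    shiftRun k k₁ k₂ w
      (update (update (update S k w) k₁ (true :: S k₁)) k₂ (true :: S k₂))

/-- The effect of a loop, by recursion on the content of the stack that controls it. -/
def loopRun (k : K) (f : (K → List Bool) → K → List Bool) :
    List Bool → (K → List Bool) → K → List Bool
  | true :: w, S => loopRun k f w (f (update S k w))
  | false :: w, S => update S k w
  | [], S => update S k []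

/-- The number of steps of a loop. -/
def loopCost (k : K) (f : (K → List Bool) → K → List Bool) (g : (K → List Bool) → ℕ) :
    List Bool → (K → List Bool) → ℕ
  | true :: w, S => 1 + g (update S k w) + loopCost k f g w (f (update S k w))
  | _, _ => 1

/-- The effect of a program on the stacks. -/
def run : StackProg K → (K → List Bool) → K → List Bool
  | push k b, S => update S k (b :: S k)
  | pop k, S => update S k (S k).tail
  | drain k, S => update S k []
  | move k k', S => update (update S k []) k' ((S k).reverse ++ S k')
  | shift k k₁ k₂, S => shiftRun k k₁ k₂ (S k) S
  | loop k p, S => loopRun k p.run (S k) S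
  | seq p q, S => q.run (p.run S)

/-- The number of steps of `shift`. -/
def shiftCost : List Bool → ℕ
  | true :: w => 1 + shiftCost w
  | _ => 1

/-- The number of steps of a program. -/
def cost : StackProg K → (K → List Bool) → ℕ
  | push _ _, _ => 1
  | pop _, _ => 1
  | drain k, S => (S k).length + 1
  | move k _, S => (S k).length + 1
  | shift k _ _, S => shiftCost (S k)
  | loop k p, S => loopCost k p.run p.cost (S k) S
  | seq p q, S => p.cost S + q.cost (p.run S)

/-- The program leaves the stack `k` alone. -/
def avoids (k : K) : StackProg K → Bool
  | push k' _ => k ≠ k'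
  | pop k' => k ≠ k'
  | drain k' => k ≠ k'
  | move k' k'' => k ≠ k' && k ≠ k''
  | shift k' k₁ k₂ => k ≠ k' && k ≠ k₁ && k ≠ k₂
  | loop k' p => k ≠ k' && p.avoids k
  | seq p q => p.avoids k && q.avoids k

/-- Bodies of loops leave the control stack alone, and stacks that have to be different are. -/
def WellFormed : StackProg K → Bool
  | push _ _ => true
  | pop _ => true
  | drain _ => true
  | move k k' => k ≠ k'
  | shift k k₁ k₂ => k ≠ k₁ && k ≠ k₂ && k₁ ≠ k₂
  | loop k p => p.avoids k && p.WellFormed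
  | seq p q => p.WellFormed && q.WellFormed

/-! ### Simulation of stack programs by machines -/

theorem run_of_avoids {k : K} : ∀ (p : StackProg K) (S : K → List Bool),
    p.avoids k = true → p.run S k = S k := by
  intro p
  induction p with
  | push k' b => intro S h; simp [avoids] at h; simp [run, h]
  | pop k' => intro S h; simp [avoids] at h; simp [run, h]
  | drain k' => intro S h; simp [avoids] at h; simp [run, h]
  | move k' k'' => intro S h; simp [avoids] at h; simp [run, h]
  | shift k' k₁ k₂ =>
    intro S h
    simp [avoids] at h
    obtain ⟨⟨h, h1⟩, h2⟩ := h
    rw [run]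
    generalize S k' = w
    induction w generalizing S with
    | nil => simp [shiftRun, h]
    | cons b w ih =>
      cases b
      · simp [shiftRun, h, h1]
      · rw [shiftRun, ih]; simp [h, h1, h2]
  | loop k' p ih =>
    intro S h
    simp [avoids] at h
    obtain ⟨h, h1⟩ := h
    rw [run]
    generalize S k' = w
    induction w generalizing S with
    | nil => simp [loopRun, h]
    | cons b w ihw =>
      cases b
      · simp [loopRun, h]
      · rw [loopRun, ihw, ih _ h1]; simp [h]
  | seq p q ihp ihq =>
    intro S h
    simp [avoids] at h
    rw [run, ihq _ h.2, ihp _ h.1]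

/-- The machine `M` goes from the first configuration to the second in `n` steps. -/
def Reach {Λ : Type} (M : Λ → MStmt K Λ) (n : ℕ) (a b : MCfg K Λ) : Prop :=
  (flip bind (TM2.step M))^[n] (some a) = some b

theorem Reach.trans {Λ : Type} {M : Λ → MStmt K Λ} {n m : ℕ} {a b c : MCfg K Λ}
    (h₁ : Reach M n a b) (h₂ : Reach M m b c) : Reach M (n + m) a c := by
  unfold Reach at *
  rw [add_comm, iterate_add_apply, h₁, h₂]

theorem Reach.head {Λ : Type} {M : Λ → MStmt K Λ} {l : Λ} {v : Option Bool}
    {S : K → List Bool} {n m : ℕ} {c : MCfg K Λ} (h : Reach M n (TM2.stepAux (M l) v S) c)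
    (hm : m = 1 + n) : Reach M m ⟨some l, v, S⟩ c := by
  subst hm
  exact Reach.trans (b := TM2.stepAux (M l) v S) rfl h

theorem Reach.refl {Λ : Type} {M : Λ → MStmt K Λ} (c : MCfg K Λ) : Reach M 0 c c := rfl

/-- A machine that contains the code of a program runs it. -/
theorem reach_run {Λ : Type} {M : Λ → MStmt K Λ} :
    ∀ (p : StackProg K) (e : p.Label → Λ) (x : Λ), p.WellFormed = true →
      (∀ l, M (e l) = p.code e x l) → ∀ (v : Option Bool) (S : K → List Bool),
      ∃ v', Reach M (p.cost S) ⟨some (e p.start), v, S⟩ ⟨some x, v', p.run S⟩ := by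
  intro p
  induction p with
  | push k b =>
    intro e x _ hM v S
    refine ⟨v, Reach.head (n := 0) ?_ rfl⟩
    rw [hM]
    exact Reach.refl _
  | pop k =>
    intro e x _ hM v S
    refine ⟨(S k).head?, Reach.head (n := 0) ?_ rfl⟩
    rw [hM]
    exact Reach.refl _
  | drain k =>
    intro e x _ hM v S
    refine ⟨none, ?_⟩
    simp only [cost, run]
    generalize hw : S k = w
    induction w generalizing v S with
    | nil =>
      refine Reach.head (n := 0) ?_ rfl
      rw [hM]
      simp [code, hw, Reach.refl]
    | cons b w ih =>
      refine Reach.head (n := w.length + 1) ?_ (by simp; omega)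
      rw [hM]
      have := ih (some b) (update S k w) (by simp)
      simpa [code, start, hw] using this
  | move k k' =>
    intro e x h hM v S
    simp [WellFormed] at h
    refine ⟨none, ?_⟩
    simp only [cost, run]
    generalize hw : S k = w
    induction w generalizing v S with
    | nil =>
      refine Reach.head (n := 0) ?_ rfl
      rw [hM]
      have : update (update S k []) k' (S k') = update S k [] := by
        rw [update_eq_self_iff]; simp [Ne.symm h]
      simp [code, hw, Reach.refl, this]
    | cons b w ih =>
      refine Reach.head (n := w.length + 1) ?_ (by simp; omega)
      rw [hM]
      have := ih (some b) (update (update S k w) k' (b :: S k')) (by simp [h])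
      rw [update_comm (Ne.symm h)] at this
      simpa [code, start, hw, Ne.symm h, update_comm h] using this
  | shift k k₁ k₂ =>
    intro e x h hM v S
    simp [WellFormed] at h
    obtain ⟨⟨h1, h2⟩, h3⟩ := h
    simp only [cost, run]
    generalize hw : S k = w
    induction w generalizing v S with
    | nil =>
      refine ⟨none, Reach.head (n := 0) ?_ rfl⟩
      rw [hM]
      simp [code, hw, Reach.refl, shiftRun]
    | cons b w ih =>
      cases b
      · refine ⟨some false, Reach.head (n := 0) ?_ rfl⟩
        rw [hM]
        simp [code, hw, Reach.refl, shiftRun, Ne.symm h1]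
      · obtain ⟨v', hv⟩ := ih (some true)
          (update (update (update S k w) k₁ (true :: S k₁)) k₂ (true :: S k₂))
          (by simp [h1, h2])
        refine ⟨v', Reach.head ?_ rfl⟩
        rw [hM]
        simpa [code, start, hw, shiftRun, Ne.symm h1, Ne.symm h2, Ne.symm h3] using hv
  | loop k p ih =>
    intro e x h hM v S
    simp [WellFormed] at h
    obtain ⟨h1, h2⟩ := h
    have key := ih (fun l => e (some l)) (e none) h2 (fun l => (hM (some l)).trans rfl)
    simp only [cost, run]
    generalize hw : S k = w
    induction w generalizing v S with
    | nil =>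
      refine ⟨none, Reach.head (n := 0) ?_ rfl⟩
      rw [hM]
      simp [code, start, hw, Reach.refl, loopRun]
    | cons b w ihw =>
      cases b
      · refine ⟨some false, Reach.head (n := 0) ?_ rfl⟩
        rw [hM]
        simp [code, start, hw, Reach.refl, loopRun]
      · obtain ⟨v₁, hv₁⟩ := key (some true) (update S k w)
        -- The body avoids `k`, so the control stack still holds `w` when the loop head is reached
        -- again, as the recursion in `loopRun` presupposes.
        obtain ⟨v₂, hv₂⟩ := ihw v₁ (p.run (update S k w)) (by
          rw [run_of_avoids _ _ h1]; simp)
        refine ⟨v₂, Reach.head (n := _ + _) ?_ (add_assoc 1 _ _)⟩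
        refine Reach.trans (b := ⟨some (e none), v₁, p.run (update S k w)⟩) ?_ hv₂
        rw [hM]
        simpa [code, start, hw] using hv₁
  | seq p q ihp ihq =>
    intro e x h hM v S
    simp [WellFormed] at h
    obtain ⟨v₁, hv₁⟩ := ihp (fun l => e (.inl l)) (e (.inr q.start)) h.1
      (fun l => (hM (.inl l)).trans rfl) v S
    obtain ⟨v₂, hv₂⟩ := ihq (fun l => e (.inr l)) x h.2
      (fun l => (hM (.inr l)).trans rfl) v₁ (p.run S)
    exact ⟨v₂, hv₁.trans hv₂⟩

/-- The code of a program followed by a halting statement. -/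
def haltCode (p : StackProg K) : Option p.Label → MStmt K (Option p.Label)
  | some l => p.code some none l
  | none => .load (fun _ => none) .halt

/-- The machine that runs a program with input stack `k₀` and output stack `k₁`, and halts. -/
def machine [Fintype K] (p : StackProg K) (k₀ k₁ : K) : FinTM2 where
  K := K
  k₀ := k₀
  k₁ := k₁
  Γ _ := Bool
  Λ := Option p.Label
  main := some p.start
  σ := Option Bool
  initialState := none
  m := p.haltCode

/-- A program that turns the word `u` on the stack `k₀` into the word `w` on the stack `k₁`, and
leaves all other stacks empty, yields a machine with output `w`. -/
theorem machine_outputs [Fintype K] {p : StackProg K} (hp : p.WellFormed = true) {k₀ k₁ : K}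
    {u w : List Bool} (h : p.run (update (fun _ => []) k₀ u) = update (fun _ => []) k₁ w) {n : ℕ}
    (hn : p.cost (update (fun _ => []) k₀ u) + 1 ≤ n) :
    Nonempty (TM2OutputsInTime (p.machine k₀ k₁) u (some w) n) := by
  have hini : initList (p.machine k₀ k₁) u =
      (⟨some (some p.start), none, update (fun _ => []) k₀ u⟩ : MCfg K (Option p.Label)) := by
    refine congrArg (fun S => (⟨some (some p.start), none, S⟩ : MCfg K (Option p.Label)))
      (funext fun k => ?_)
    by_cases hk : k₀ = k
    · subst hk
      exact (dif_pos rfl).trans (update_self k₀ u (fun _ : K => ([] : List Bool))).symm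
    · exact (dif_neg (Ne.symm hk)).trans
        (update_of_ne (β := fun _ : K => List Bool) (Ne.symm hk) u (fun _ => [])).symm
  have hhalt : haltList (p.machine k₀ k₁) w =
      (⟨none, none, update (fun _ => []) k₁ w⟩ : MCfg K (Option p.Label)) := by
    refine congrArg (fun S => (⟨none, none, S⟩ : MCfg K (Option p.Label))) (funext fun k => ?_)
    by_cases hk : k₁ = k
    · subst hk
      exact (dif_pos rfl).trans (update_self k₁ w (fun _ : K => ([] : List Bool))).symm
    · exact (dif_neg (Ne.symm hk)).trans
        (update_of_ne (β := fun _ : K => List Bool) (Ne.symm hk) w (fun _ => [])).symm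
  obtain ⟨v, hv⟩ := reach_run (M := p.haltCode) p some none hp (fun l => rfl) none
    (update (fun _ => []) k₀ u)
  rw [h] at hv
  -- One last step halts and resets the remembered symbol, because `haltList` demands the initial
  -- memory `none`.
  have hv' := hv.trans (Reach.head (n := 0) (Reach.refl _) rfl)
  refine ⟨⟨⟨p.cost (update (fun _ => []) k₀ u) + 1, ?_⟩, hn⟩⟩
  refine Eq.trans ?_ (Eq.trans hv' (congrArg some hhalt.symm))
  exact congrArg (fun c => (flip bind (TM2.step p.haltCode))^[_] (some c)) hini

end StackProg

/-! ## Commands with registers, and their translation to stack programs -/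

namespace StackProg

open Function

variable {K : Type}

/-- Add the unary number on the stack `y` to the stack `k`, with `t` as an auxiliary stack. -/
def copy (t y k : K) : StackProg K :=
  seq (loop y (seq (push t true) (push k true))) (move t y)

variable [DecidableEq K]

theorem cost_seq (p q : StackProg K) (S : K → List Bool) :
    (seq p q).cost S = p.cost S + q.cost (p.run S) := rfl

theorem cost_loop (k : K) (p : StackProg K) (S : K → List Bool) :
    (loop k p).cost S = loopCost k p.run p.cost (S k) S := rfl

theorem cost_drain (k : K) (S : K → List Bool) : (drain k).cost S = (S k).length + 1 := rfl

theorem shiftCost_le (w : List Bool) : shiftCost w ≤ w.length + 1 := by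
  induction w with
  | nil => simp [shiftCost]
  | cons b w ih =>
    cases b
    · simp [shiftCost]
    · simp only [shiftCost, List.length_cons]; omega

theorem loop_copy_run {t y k : K} (hty : t ≠ y) (hky : k ≠ y) (htk : t ≠ k) (m : ℕ)
    (S : K → List Bool) :
    loopRun y (seq (push t true) (push k true)).run (List.replicate m true) S =
        update (update (update S y []) t (List.replicate m true ++ S t)) k
          (List.replicate m true ++ S k) ∧
      loopCost y (seq (push t true) (push k true)).run (seq (push t true) (push k true)).cost
        (List.replicate m true) S = 3 * m + 1 := by
  induction m generalizing S with
  | zero =>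
    refine ⟨?_, rfl⟩
    have h1 : update (update S y []) t (S t) = update S y [] := by simp [hty]
    have h2 : update (update S y []) k (S k) = update S y [] := by simp [hky]
    simp [loopRun, h1, h2]
  | succ m ih =>
    rw [List.replicate_succ, loopRun, loopCost, (ih _).1, (ih _).2]
    constructor
    · funext z
      have hrep : ∀ l : List Bool,
          List.replicate m true ++ true :: l = true :: (List.replicate m true ++ l) := by
        intro l
        rw [← List.cons_append, ← List.replicate_succ, List.replicate_succ']
        simp
      by_cases h1 : z = k
      · subst h1; simp [run, hty, hky, htk, Ne.symm htk, hrep]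
      by_cases h2 : z = t
      · subst h2; simp [run, hty, htk, hrep]
      by_cases h3 : z = y
      · subst h3; simp [run, h1, h2]
      · simp [run, h1, h2, h3]
    · simp [cost]; ring

/-- The loop empties `y` into both `t` and `k`; since `t` was empty before, pouring it back restores
`y` and leaves `t` empty. The cost is `3 * m + 1` for the loop and `m + 1` for the move. -/
theorem copy_run {t y k : K} (hty : t ≠ y) (hky : k ≠ y) (htk : t ≠ k) (m : ℕ)
    (S : K → List Bool) (hy : S y = List.replicate m true) (ht : S t = []) :
    (copy t y k).run S = update S k (List.replicate m true ++ S k) ∧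
      (copy t y k).cost S = 4 * m + 2 := by
  obtain ⟨h1, h2⟩ := loop_copy_run hty hky htk m S
  have h0 : (loop y (seq (push t true) (push k true))).run S =
      update (update (update S y []) t (List.replicate m true ++ S t)) k
        (List.replicate m true ++ S k) := by rw [run, hy, h1]
  constructor
  · rw [copy, run, h0, run]
    funext z
    by_cases h1 : z = k
    · subst h1; simp [hky, Ne.symm htk]
    by_cases h2 : z = t
    · simp [h2, hty, ht, htk]
    by_cases h3 : z = y
    · subst h3; simp [hy, htk, ht, Ne.symm hty, Ne.symm hky]
    · simp [h1, h2, h3]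
  · rw [copy, cost_seq, h0, cost_loop, hy, h2, cost]
    simp [htk, ht]
    ring

end StackProg

/-- The stacks: input to the right and to the left of the reading position, output in reverse order
and in right order, an auxiliary stack, registers, and counters that control loops. -/
inductive Stk where
  | inp
  | left
  | out
  | res
  | tmp
  | reg (i : Fin 32)
  | ctr (i : Fin 32)
  deriving DecidableEq, Fintype

/-- The input, split at the reading position, and the output, both to the left in reverse order. -/
structure Tape where
  left : List Bool
  inp : List Bool
  out : List Bool

namespace Tape

/-- The length of the input. -/
def size (t : Tape) : ℕ := t.left.length + t.inp.length

/-- Read the leading unary number of a word: its value, the symbols read (in reverse order, in front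
of `l`), and the rest. -/
def readAux : List Bool → List Bool → ℕ × List Bool × List Bool
  | [], l => (0, l, [])
  | false :: w, l => (0, false :: l, w)
  | true :: w, l => ((readAux w (true :: l)).1 + 1, (readAux w (true :: l)).2)

/-- The number at the reading position. -/
def val (t : Tape) : ℕ := (readAux t.inp t.left).1

/-- The tape with the reading position moved behind the number read. -/
def next (t : Tape) : Tape :=
  ⟨(readAux t.inp t.left).2.1, (readAux t.inp t.left).2.2, t.out⟩

/-- The tape with the reading position moved to the start. -/
def rewind (t : Tape) : Tape := ⟨[], t.left.reverse ++ t.inp, t.out⟩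

/-- The tape with a word written to the output. -/
def write (t : Tape) (w : List Bool) : Tape := ⟨t.left, t.inp, w.reverse ++ t.out⟩

theorem readAux_size (w l : List Bool) :
    (readAux w l).2.1.length + (readAux w l).2.2.length = l.length + w.length ∧
      (readAux w l).1 ≤ w.length := by
  induction w generalizing l with
  | nil => simp [readAux]
  | cons b w ih =>
    cases b
    · simp [readAux]; omega
    · have := ih (true :: l)
      simp [readAux] at this ⊢
      omega

theorem size_next (t : Tape) : t.next.size = t.size := (readAux_size t.inp t.left).1

theorem val_le_size (t : Tape) : t.val ≤ t.size :=
  (readAux_size t.inp t.left).2.trans (Nat.le_add_left _ _)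

theorem size_rewind (t : Tape) : t.rewind.size = t.size := by simp [rewind, size]

end Tape

/-- Commands. `rep q y p` runs `p` for `q = 0, …, y - 1`; `read q p` runs `p` with `q` set to the
number at the reading position, and `sub q x y p` with `q` set to `x - y`; `inc q p` runs `p` with
`q` increased by one. The registers get back their old values afterwards. -/
inductive Cmd where
  | emit (b : Bool)
  | skip
  | rewind
  | seq (p q : Cmd)
  | rep (q y : Fin 32) (p : Cmd)
  | read (q : Fin 32) (p : Cmd)
  | sub (q x y : Fin 32) (p : Cmd)
  | inc (q : Fin 32) (p : Cmd)

namespace Cmd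

open Function StackProg

/-- The stack program of a command. -/
def compile : Cmd → StackProg Stk
  | emit b => .push .out b
  | skip => .seq (.shift .inp .left .tmp) (.drain .tmp)
  | rewind => .move .left .inp
  | seq p q => .seq p.compile q.compile
  | rep q y p => .seq (copy .tmp (.reg y) (.ctr q))
      (.seq (.loop (.ctr q) (.seq p.compile (.push (.reg q) true))) (.drain (.reg q)))
  | read q p => .seq (.shift .inp .left (.reg q)) (.seq p.compile (.drain (.reg q)))
  | sub q x y p => .seq (copy .tmp (.reg x) (.reg q)) (.seq (copy .tmp (.reg y) (.ctr q))
      (.seq (.loop (.ctr q) (.pop (.reg q))) (.seq p.compile (.drain (.reg q)))))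
  | inc q p => .seq (.push (.reg q) true) (.seq p.compile (.pop (.reg q)))

/-- The effect of a command on the tape, given the values of the registers. -/
def den : Cmd → (Fin 32 → ℕ) → Tape → Tape
  | emit b, _, t => t.write [b]
  | skip, _, t => t.next
  | rewind, _, t => t.rewind
  | seq p q, e, t => q.den e (p.den e t)
  | rep q y p, e, t => (List.range (e y)).foldl (fun t i => p.den (update e q i) t) t
  | read q p, e, t => p.den (update e q t.val) t.next
  | sub q x y p, e, t => p.den (update e q (e x - e y)) t
  | inc q p, e, t => p.den (update e q (e q + 1)) t

/-- Registers are used as a stack of local variables: `L` is the first free register. -/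
def ok : ℕ → Cmd → Bool
  | _, emit _ => true
  | _, skip => true
  | _, rewind => true
  | L, seq p q => ok L p && ok L q
  | L, rep q _ p => decide (q.val = L) && ok (L + 1) p
  | L, read q p => decide (q.val = L) && ok (L + 1) p
  | L, sub q x y p =>
    decide (q.val = L) && decide (x.val < L) && decide (y.val < L) && ok (L + 1) p
  | L, inc q p => decide (q.val < L) && ok L p

/-- A bound on the running time and on the length of the output, if `N` bounds the registers and
the length of the input. -/
def bound : Cmd → ℕ → ℕ
  | emit _, _ => 2
  | skip, N => 2 * N + 3
  | rewind, N => N + 1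
  | seq p q, N => p.bound N + q.bound N
  | rep _ _ p, N => N * (p.bound N + 2) + (5 * N + 4)
  | read _ p, N => p.bound N + (2 * N + 2)
  | sub _ _ _ p, N => p.bound N + (11 * N + 6)
  | inc _ p, N => p.bound (N + 1) + 2

/-- Polynomially bounded functions are closed under sums, under multiplication by `N` (one degree
more for each `rep`), and under replacing `N` by `N + 1` (for `inc`). -/
theorem bound_poly (p : Cmd) : ∃ C d : ℕ, ∀ N, p.bound N ≤ C * (N + 1) ^ d := by
  have hlin : ∀ a b : ℕ, ∀ N : ℕ, a * N + b ≤ (a + b) * (N + 1) ^ 1 := by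
    intro a b N; nlinarith
  have hadd : ∀ {f g : ℕ → ℕ}, (∃ C d : ℕ, ∀ N, f N ≤ C * (N + 1) ^ d) →
      (∃ C d : ℕ, ∀ N, g N ≤ C * (N + 1) ^ d) →
      ∃ C d : ℕ, ∀ N, f N + g N ≤ C * (N + 1) ^ d := by
    rintro f g ⟨C, d, h⟩ ⟨C', d', h'⟩
    refine ⟨C + C', d + d', fun N => ?_⟩
    have h1 : (N + 1) ^ d ≤ (N + 1) ^ (d + d') := Nat.pow_le_pow_right (by omega) (by omega)
    have h2 : (N + 1) ^ d' ≤ (N + 1) ^ (d + d') := Nat.pow_le_pow_right (by omega) (by omega)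
    calc f N + g N ≤ C * (N + 1) ^ d + C' * (N + 1) ^ d' := add_le_add (h N) (h' N)
      _ ≤ C * (N + 1) ^ (d + d') + C' * (N + 1) ^ (d + d') := by gcongr
      _ = _ := by ring
  induction p with
  | emit b => exact ⟨2, 0, fun N => by simp [bound]⟩
  | skip => exact ⟨_, 1, hlin 2 3⟩
  | rewind => exact ⟨1, 1, fun N => by simp [bound]⟩
  | seq p q ihp ihq => exact hadd ihp ihq
  | rep q y p ih =>
    refine hadd ?_ ⟨_, 1, hlin 5 4⟩
    obtain ⟨C, d, h⟩ := hadd (g := fun _ => 2) ih ⟨2, 0, fun N => by simp⟩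
    refine ⟨C, d + 1, fun N => ?_⟩
    calc N * (p.bound N + 2) ≤ (N + 1) * (C * (N + 1) ^ d) :=
          Nat.mul_le_mul (Nat.le_succ N) (h N)
      _ = _ := by ring
  | read q p ih => exact hadd ih ⟨_, 1, hlin 2 2⟩
  | sub q x y p ih => exact hadd ih ⟨_, 1, hlin 11 6⟩
  | inc q p ih =>
    refine hadd (g := fun _ => 2) ?_ ⟨2, 0, fun N => by simp⟩
    obtain ⟨C, d, h⟩ := ih
    -- The factor `2 ^ d` comes from `N + 2 ≤ 2 * (N + 1)`.
    refine ⟨C * 2 ^ d, d, fun N => (h (N + 1)).trans ?_⟩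
    rw [mul_assoc, ← mul_pow]
    gcongr
    omega

/-! ### Correctness and cost of compiled commands -/

/-- The stacks that hold given registers, counters, and a tape. -/
def enc (e c : Fin 32 → ℕ) (t : Tape) : Stk → List Bool
  | .inp => t.inp
  | .left => t.left
  | .out => t.out
  | .res => []
  | .tmp => []
  | .reg i => List.replicate (e i) true
  | .ctr i => List.replicate (c i) true

theorem update_enc_reg (e c : Fin 32 → ℕ) (t : Tape) (q : Fin 32) (n : ℕ) :
    update (enc e c t) (.reg q) (List.replicate n true) = enc (update e q n) c t := by
  funext z
  cases z with
  | reg i =>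
    by_cases h : i = q
    · subst h; simp [enc]
    · simp [enc, h]
  | _ => simp [enc]

theorem update_enc_ctr (e c : Fin 32 → ℕ) (t : Tape) (q : Fin 32) (n : ℕ) :
    update (enc e c t) (.ctr q) (List.replicate n true) = enc e (update c q n) t := by
  funext z
  cases z with
  | ctr i =>
    by_cases h : i = q
    · subst h; simp [enc]
    · simp [enc, h]
  | _ => simp [enc]

theorem drain_enc_reg (e c : Fin 32 → ℕ) (t : Tape) (q : Fin 32) :
    (StackProg.drain (.reg q)).run (enc e c t) = enc (update e q 0) c t := by
  rw [StackProg.run, ← update_enc_reg, List.replicate_zero]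

theorem copy_enc_ctr (e c : Fin 32 → ℕ) (t : Tape) (y q : Fin 32) (hq : c q = 0) :
    (copy .tmp (.reg y) (.ctr q)).run (enc e c t) = enc e (update c q (e y)) t ∧
      (copy .tmp (.reg y) (.ctr q)).cost (enc e c t) = 4 * e y + 2 := by
  obtain ⟨h1, h2⟩ := copy_run (t := Stk.tmp) (y := .reg y) (k := .ctr q) (by simp) (by simp)
    (by simp) (e y) (enc e c t) rfl rfl
  refine ⟨?_, h2⟩
  rw [h1, ← update_enc_ctr]
  simp [enc, hq]

theorem copy_enc_reg (e c : Fin 32 → ℕ) (t : Tape) {y q : Fin 32} (hqy : q ≠ y) (hq : e q = 0) :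
    (copy .tmp (.reg y) (.reg q)).run (enc e c t) = enc (update e q (e y)) c t ∧
      (copy .tmp (.reg y) (.reg q)).cost (enc e c t) = 4 * e y + 2 := by
  obtain ⟨h1, h2⟩ := copy_run (t := Stk.tmp) (y := .reg y) (k := .reg q) (by simp) (by simpa)
    (by simp) (e y) (enc e c t) rfl rfl
  refine ⟨?_, h2⟩
  rw [h1, ← update_enc_reg]
  simp [enc, hq]

theorem shift_enc_reg (e c : Fin 32 → ℕ) (t : Tape) (q : Fin 32) :
    (StackProg.shift .inp .left (.reg q)).run (enc e c t) =
        enc (update e q (e q + t.val)) c t.next ∧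
      (StackProg.shift .inp .left (.reg q)).cost (enc e c t) ≤ t.size + 1 := by
  obtain ⟨l, w, o⟩ := t
  refine ⟨?_, (shiftCost_le w).trans (by simp [Tape.size])⟩
  simp only [StackProg.run, Tape.val, Tape.next]
  induction w generalizing l e with
  | nil =>
    funext z
    cases z <;> simp [enc, shiftRun, Tape.readAux]
  | cons b w ih =>
    cases b
    · funext z
      cases z <;> simp [enc, shiftRun, Tape.readAux]
    · have hu : update (update (update (enc e c ⟨l, true :: w, o⟩) .inp w) .left (true :: l))
          (.reg q) (true :: List.replicate (e q) true) =
          enc (update e q (e q + 1)) c ⟨true :: l, w, o⟩ := by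
        rw [← List.replicate_succ]
        funext z
        cases z with
        | reg i =>
          by_cases h : i = q
          · subst h; simp [enc]
          · simp [enc, h]
        | _ => simp [enc]
      have h1 := ih (update e q (e q + 1)) (true :: l)
      simp only [enc] at h1 hu ⊢
      rw [shiftRun]
      simp only [enc]
      rw [hu, h1]
      simp [Tape.readAux]
      congr 2
      omega

theorem skip_run (e c : Fin 32 → ℕ) (t : Tape) :
    skip.compile.run (enc e c t) = enc e c t.next ∧
      skip.compile.cost (enc e c t) ≤ 2 * t.size + 3 := by
  -- While numbers are shifted, `tmp` is nonempty and the stacks are not of the form `enc`; the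
  -- invariant therefore carries the content of `tmp` separately.
  have key : ∀ (w l o : List Bool) (m : ℕ) (S : Stk → List Bool),
      S = update (enc e c ⟨l, w, o⟩) .tmp (List.replicate m true) →
      shiftRun .inp .left .tmp w S = update (enc e c (Tape.next ⟨l, w, o⟩)) .tmp
        (List.replicate (m + Tape.val ⟨l, w, o⟩) true) := by
    intro w
    induction w with
    | nil =>
      rintro l o m S rfl
      funext z
      cases z <;> simp [enc, shiftRun, Tape.readAux, Tape.next, Tape.val]
    | cons b w ih =>
      rintro l o m S rfl
      cases b
      · funext z
        cases z <;> simp [enc, shiftRun, Tape.readAux, Tape.next, Tape.val]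
      · have h1 := ih (true :: l) o (m + 1)
          (update (enc e c ⟨true :: l, w, o⟩) .tmp (List.replicate (m + 1) true)) rfl
        rw [shiftRun]
        have hv : m + Tape.val ⟨l, true :: w, o⟩ = m + 1 + Tape.val ⟨true :: l, w, o⟩ := by
          simp only [Tape.val, Tape.readAux]; omega
        rw [hv]
        refine Eq.trans ?_ h1
        congr 1
        funext z
        cases z <;> simp [enc, List.replicate_succ]
  obtain ⟨l, w, o⟩ := t
  have h1 := key w l o 0 (enc e c ⟨l, w, o⟩) (by
    funext z
    cases z <;> simp [enc])
  have h2 := shiftCost_le w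
  have hv := (Tape.readAux_size w l).2
  simp only [compile, StackProg.run, StackProg.cost]
  simp only [enc] at h1 ⊢
  constructor
  · rw [h1]
    funext z
    cases z <;> simp [enc]
  · rw [h1]
    simp [Tape.val, Tape.size]
    omega

theorem rewind_run (e c : Fin 32 → ℕ) (t : Tape) :
    rewind.compile.run (enc e c t) = enc e c t.rewind := by
  funext z
  cases z <;> simp [compile, StackProg.run, enc, Tape.rewind]

/-- The registers and counters from `L` on are zero. -/
def Free (L : ℕ) (e c : Fin 32 → ℕ) : Prop := ∀ q : Fin 32, L ≤ q.val → e q = 0 ∧ c q = 0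

theorem Free.update {L : ℕ} {e c : Fin 32 → ℕ} (h : Free L e c) {q : Fin 32} (hq : q.val = L)
    (n m : ℕ) : Free (L + 1) (update e q n) (update c q m) := by
  intro i hi
  have : i ≠ q := by rintro rfl; omega
  simpa [this] using h i (by omega)

theorem Free.update_reg {L : ℕ} {e c : Fin 32 → ℕ} (h : Free L e c) {q : Fin 32} (hq : q.val < L)
    (n : ℕ) : Free L (Function.update e q n) c := by
  intro i hi
  have : i ≠ q := by rintro rfl; omega
  simpa [this] using h i hi

theorem update_le {e : Fin 32 → ℕ} {N n : ℕ} {q : Fin 32} (he : ∀ i, e i ≤ N) (hn : n ≤ N)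
    (i : Fin 32) : update e q n i ≤ N := by
  by_cases h : i = q
  · subst h; simpa
  · simpa [h] using he i

/-- Popping an empty stack does nothing, which is truncated subtraction. -/
theorem loop_pop_run (e c : Fin 32 → ℕ) (t : Tape) (q : Fin 32) (n : ℕ) :
    loopRun (.ctr q) (StackProg.pop (.reg q)).run (List.replicate n true) (enc e c t) =
        enc (update e q (e q - n)) (update c q 0) t ∧
      loopCost (.ctr q) (StackProg.pop (.reg q)).run (StackProg.pop (.reg q)).cost
        (List.replicate n true) (enc e c t) = 2 * n + 1 := by
  induction n generalizing e c with
  | zero =>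
    refine ⟨?_, rfl⟩
    rw [← update_enc_ctr]
    simp [loopRun]
  | succ n ih =>
    have hp : (StackProg.pop (.reg q)).run (enc e (update c q n) t) =
        enc (update e q (e q - 1)) (update c q n) t := by
      rw [StackProg.run, ← update_enc_reg]
      simp [enc]
    rw [List.replicate_succ, loopRun, loopCost, update_enc_ctr, hp, (ih _ _).1, (ih _ _).2]
    constructor
    · simp [Nat.sub_sub, add_comm]
    · simp [StackProg.cost]; ring

/-- The specification of a command whose first free register is `L`. -/
def Correct (L : ℕ) (p : Cmd) : Prop :=
  ∀ (e c : Fin 32 → ℕ) (t : Tape), Free L e c →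
    p.compile.run (enc e c t) = enc e c (p.den e t) ∧ (p.den e t).size ≤ t.size ∧
    ∀ N, (∀ q, e q ≤ N) → t.size ≤ N →
      p.compile.cost (enc e c t) + (p.den e t).out.length ≤ t.out.length + p.bound N

theorem correct_rep {L : ℕ} {q y : Fin 32} {p : Cmd} (hq : q.val = L)
    (hp : Correct (L + 1) p) : Correct L (rep q y p) := by
  intro e c t hf
  -- Induction on the number `n` of rounds left, from the loop index `i`. The stored counter `m` is
  -- arbitrary, since `loopRun` overwrites that stack with its own list.
  have hloop : ∀ (n i m : ℕ) (t : Tape),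
      loopRun (.ctr q) (StackProg.seq p.compile (.push (.reg q) true)).run
          (List.replicate n true) (enc (update e q i) (update c q m) t) =
        enc (update e q (i + n)) (update c q 0)
          ((List.range' i n).foldl (fun t i => p.den (update e q i) t) t) ∧
      ((List.range' i n).foldl (fun t i => p.den (update e q i) t) t).size ≤ t.size ∧
      ∀ N, (∀ q, e q ≤ N) → t.size ≤ N → i + n ≤ N →
        loopCost (.ctr q) (StackProg.seq p.compile (.push (.reg q) true)).run
          (StackProg.seq p.compile (.push (.reg q) true)).cost
          (List.replicate n true) (enc (update e q i) (update c q m) t) +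
          ((List.range' i n).foldl (fun t i => p.den (update e q i) t) t).out.length ≤
        t.out.length + (n * (p.bound N + 2) + 1) := by
    intro n
    induction n with
    | zero =>
      intro i m t
      refine ⟨?_, le_rfl, fun N _ _ _ => ?_⟩
      · have := update_enc_ctr (update e q i) (update c q m) t q 0
        rw [update_idem] at this
        exact this
      · simp [loopCost]; omega
    | succ n ih =>
      intro i m t
      obtain ⟨h1, h2, h3⟩ := hp (update e q i) (update c q n) t (hf.update hq i n)
      have hpush : (StackProg.push (Stk.reg q) true).run
          (enc (update e q i) (update c q n) (p.den (update e q i) t)) =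
          enc (update e q (i + 1)) (update c q n) (p.den (update e q i) t) := by
        rw [StackProg.run]
        have : true :: enc (update e q i) (update c q n) (p.den (update e q i) t) (.reg q) =
          List.replicate (i + 1) true := by simp [enc, List.replicate_succ]
        rw [this, update_enc_reg, update_idem]
      have hbody : (StackProg.seq p.compile (.push (.reg q) true)).run
          (enc (update e q i) (update c q n) t) =
          enc (update e q (i + 1)) (update c q n) (p.den (update e q i) t) := by
        rw [StackProg.run, h1, hpush]
      obtain ⟨h4, h5, h6⟩ := ih (i + 1) n (p.den (update e q i) t)
      rw [List.replicate_succ, loopRun, loopCost, update_enc_ctr, update_idem, hbody, h4,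
        List.range'_succ, List.foldl_cons]
      refine ⟨by rw [add_assoc, add_comm 1 n], h5.trans h2, fun N he ht hN => ?_⟩
      have h7 := h6 N he (h2.trans ht) (by omega)
      have h8 := h3 N (update_le he (by omega)) ht
      simp only [StackProg.cost] at h7 ⊢
      rw [add_mul, one_mul]
      omega
  obtain ⟨hc1, hc2⟩ := copy_enc_ctr e c t y q (hf q hq.ge).2
  have he0 : update e q 0 = e := by simp [(hf q hq.ge).1]
  have hc0 : update c q 0 = c := by simp [(hf q hq.ge).2]
  obtain ⟨h1, h2, h3⟩ := hloop (e y) 0 (e y) t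
  rw [he0, hc0, zero_add, ← List.range_eq_range'] at h1
  rw [← List.range_eq_range'] at h2
  have hl : enc e (update c q (e y)) t (.ctr q) = List.replicate (e y) true := by simp [enc]
  have hr : (StackProg.loop (.ctr q) (StackProg.seq p.compile (.push (.reg q) true))).run
      (enc e (update c q (e y)) t) = enc (update e q (e y)) c ((rep q y p).den e t) := by
    rw [StackProg.run, hl, h1, den]
  refine ⟨?_, h2, fun N he ht => ?_⟩
  · simp only [compile]
    rw [StackProg.run, hc1, StackProg.run, hr, drain_enc_reg, update_idem, he0]
  · have h4 := h3 N he ht (by simpa using he y)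
    rw [he0, ← List.range_eq_range'] at h4
    simp only [compile]
    -- Besides the rounds, the copy costs `4 * e y + 2`, the failing test of the loop `1`, and the
    -- final drain `e y + 1`; this is the `5 * N + 4` in `bound`.
    rw [cost_seq, hc1, hc2, cost_seq, hr, cost_loop, hl, cost_drain, bound]
    have h8 : (rep q y p).den e t =
      (List.range (e y)).foldl (fun t i => p.den (update e q i) t) t := rfl
    rw [← h8] at h4
    have h5 : (enc (update e q (e y)) c ((rep q y p).den e t) (.reg q)).length = e y := by
      simp [enc]
    rw [h5]
    have h6 := he y
    have h7 : e y * (p.bound N + 2) ≤ N * (p.bound N + 2) := Nat.mul_le_mul_right _ h6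
    omega

theorem correct_read {L : ℕ} {q : Fin 32} {p : Cmd} (hq : q.val = L)
    (hp : Correct (L + 1) p) : Correct L (read q p) := by
  intro e c t hf
  obtain ⟨hs1, hs2⟩ := shift_enc_reg e c t q
  rw [(hf q hq.ge).1, zero_add] at hs1
  have he0 : update e q 0 = e := by simp [(hf q hq.ge).1]
  have hc0 : update c q 0 = c := by simp [(hf q hq.ge).2]
  have hf' := hf.update hq t.val 0
  rw [hc0] at hf'
  obtain ⟨h1, h2, h3⟩ := hp (update e q t.val) c t.next hf'
  refine ⟨?_, h2.trans t.size_next.le, fun N he ht => ?_⟩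
  · simp only [compile]
    rw [StackProg.run, hs1, StackProg.run, h1, drain_enc_reg, update_idem, he0, den]
  · simp only [compile]
    have h4 := t.val_le_size
    have h5 := h3 N (update_le he (h4.trans ht)) (t.size_next.le.trans ht)
    rw [cost_seq, hs1, cost_seq, h1, cost_drain, bound, den]
    have h6 : (enc (update e q t.val) c (p.den (update e q t.val) t.next) (.reg q)).length =
      t.val := by simp [enc]
    have h7 : t.next.out.length = t.out.length := rfl
    omega

theorem correct_sub {L : ℕ} {q x y : Fin 32} {p : Cmd} (hq : q.val = L) (hx : x.val < L)
    (hy : y.val < L) (hp : Correct (L + 1) p) : Correct L (sub q x y p) := by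
  intro e c t hf
  have hqx : q ≠ x := by rintro rfl; omega
  have hqy : y ≠ q := by rintro rfl; omega
  have he0 : update e q 0 = e := by simp [(hf q hq.ge).1]
  have hc0 : update c q 0 = c := by simp [(hf q hq.ge).2]
  obtain ⟨hx1, hx2⟩ := copy_enc_reg e c t hqx (hf q hq.ge).1
  obtain ⟨hy1, hy2⟩ := copy_enc_ctr (update e q (e x)) c t y q (hf q hq.ge).2
  rw [update_of_ne hqy] at hy1 hy2
  obtain ⟨hl1, hl2⟩ := loop_pop_run (update e q (e x)) (update c q (e y)) t q (e y)
  rw [update_self, update_idem, update_idem, hc0] at hl1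
  have hf' := hf.update hq (e x - e y) 0
  rw [hc0] at hf'
  obtain ⟨h1, h2, h3⟩ := hp (update e q (e x - e y)) c t hf'
  have hl : enc (update e q (e x)) (update c q (e y)) t (.ctr q) =
    List.replicate (e y) true := by simp [enc]
  have hr : (StackProg.loop (.ctr q) (StackProg.pop (.reg q))).run
      (enc (update e q (e x)) (update c q (e y)) t) = enc (update e q (e x - e y)) c t := by
    rw [StackProg.run, hl, hl1]
  refine ⟨?_, h2, fun N he ht => ?_⟩
  · simp only [compile]
    rw [StackProg.run, hx1, StackProg.run, hy1, StackProg.run, hr, StackProg.run, h1,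
      drain_enc_reg, update_idem, he0, den]
  · simp only [compile]
    have h4 := he x
    have h5 := he y
    have h6 := h3 N (update_le he (by omega)) ht
    rw [cost_seq, hx1, hx2, cost_seq, hy1, hy2, cost_seq, hr, cost_loop, cost_seq, h1, hl, hl2,
      cost_drain, bound, den]
    have h7 : (enc (update e q (e x - e y)) c (p.den (update e q (e x - e y)) t)
      (.reg q)).length = e x - e y := by simp [enc]
    omega

theorem correct_inc {L : ℕ} {q : Fin 32} {p : Cmd} (hq : q.val < L)
    (hp : Correct L p) : Correct L (inc q p) := by
  intro e c t hf
  obtain ⟨h1, h2, h3⟩ := hp (update e q (e q + 1)) c t (hf.update_reg hq _)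
  have hpush : (StackProg.push (Stk.reg q) true).run (enc e c t) =
      enc (update e q (e q + 1)) c t := by
    rw [StackProg.run, ← update_enc_reg]
    simp [enc, List.replicate_succ]
  have hpop : (StackProg.pop (Stk.reg q)).run
      (enc (update e q (e q + 1)) c (p.den (update e q (e q + 1)) t)) =
      enc e c (p.den (update e q (e q + 1)) t) := by
    have : (enc (update e q (e q + 1)) c (p.den (update e q (e q + 1)) t) (.reg q)).tail =
      List.replicate (e q) true := by simp [enc]
    rw [StackProg.run, this, update_enc_reg]
    simp
  refine ⟨?_, h2, fun N he ht => ?_⟩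
  · simp only [compile]
    rw [StackProg.run, hpush, StackProg.run, h1, hpop, den]
  · simp only [compile]
    rw [cost_seq, hpush, cost_seq, StackProg.cost, StackProg.cost, bound, den]
    have h4 := he q
    have h6 := h3 (N + 1) (update_le (fun i => (he i).trans (Nat.le_succ N)) (by omega))
      (ht.trans (Nat.le_succ N))
    omega

/-- The discipline `ok` ensures that a newly opened register and its counter are zero, so clearing
them afterwards restores the registers. The cost inequality includes the output length so that the
same bound also pays for reversing the output at the end. -/
theorem correct_of_ok (p : Cmd) : ∀ L, ok L p = true → Correct L p := by
  induction p with
  | emit b =>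
    intro L _ e c t _
    refine ⟨?_, le_rfl, fun N _ _ => ?_⟩
    · funext z
      cases z <;> simp [compile, StackProg.run, enc, den, Tape.write]
    · simp [compile, StackProg.cost, den, Tape.write, bound]
      omega
  | skip =>
    intro L _ e c t _
    obtain ⟨h1, h2⟩ := skip_run e c t
    refine ⟨h1, t.size_next.le, fun N _ ht => ?_⟩
    have : (skip.den e t).out.length = t.out.length := rfl
    rw [bound]
    omega
  | rewind =>
    intro L _ e c t _
    refine ⟨rewind_run e c t, t.size_rewind.le, fun N _ ht => ?_⟩
    have h1 : (rewind.den e t).out.length = t.out.length := rfl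
    have h2 : rewind.compile.cost (enc e c t) = t.left.length + 1 := rfl
    have h3 : t.size = t.left.length + t.inp.length := rfl
    rw [bound]
    omega
  | seq p q ihp ihq =>
    intro L h e c t hf
    simp only [ok, Bool.and_eq_true] at h
    obtain ⟨h1, h2, h3⟩ := ihp L h.1 e c t hf
    obtain ⟨h4, h5, h6⟩ := ihq L h.2 e c (p.den e t) hf
    refine ⟨?_, h5.trans h2, fun N he ht => ?_⟩
    · simp only [compile]
      rw [StackProg.run, h1, h4, den]
    · simp only [compile]
      rw [cost_seq, h1, bound, den]
      have := h3 N he ht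
      have := h6 N he (h2.trans ht)
      omega
  | rep q y p ih =>
    intro L h
    simp only [ok, Bool.and_eq_true, decide_eq_true_eq] at h
    exact correct_rep h.1 (ih _ h.2)
  | read q p ih =>
    intro L h
    simp only [ok, Bool.and_eq_true, decide_eq_true_eq] at h
    exact correct_read h.1 (ih _ h.2)
  | sub q x y p ih =>
    intro L h
    simp only [ok, Bool.and_eq_true, decide_eq_true_eq] at h
    exact correct_sub h.1.1.1 h.1.1.2 h.1.2 (ih _ h.2)
  | inc q p ih =>
    intro L h
    simp only [ok, Bool.and_eq_true, decide_eq_true_eq] at h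
    exact correct_inc h.1 (ih _ h.2)

/-- Run a command, clear the input, and put the output in order. -/
def toProg (p : Cmd) : StackProg Stk :=
  .seq p.compile (.seq (.drain .left) (.seq (.drain .inp) (.move .out .res)))

/-- A command that writes the word `w` when started on the input `u` yields a machine that outputs
`w`, in polynomial time. -/
theorem exists_machine (p : Cmd) (h : ok 1 p = true) (hw : p.toProg.WellFormed = true) :
    ∃ C d : ℕ, ∀ u : List Bool,
      Nonempty (Turing.TM2OutputsInTime (p.toProg.machine .inp .res) u
        (some (p.den (fun _ => 0) ⟨[], u, []⟩).out.reverse) (C * (u.length + 1) ^ d)) := by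
  obtain ⟨C, d, hC⟩ := bound_poly p
  -- Beyond `bound`, clearing the two input stacks, reversing the output and halting need at most
  -- `u.length + 4` steps, which the additional `5` and the higher degree absorb.
  refine ⟨C + 5, d + 1, fun u => ?_⟩
  obtain ⟨h1, h2, h3⟩ := correct_of_ok p 1 h (fun _ => 0) (fun _ => 0) ⟨[], u, []⟩
    (fun q _ => ⟨rfl, rfl⟩)
  have hini : update (fun _ => []) Stk.inp u = enc (fun _ => 0) (fun _ => 0) ⟨[], u, []⟩ := by
    funext z
    cases z <;> simp [enc]
  generalize ht : p.den (fun _ => 0) ⟨[], u, []⟩ = t at *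
  refine StackProg.machine_outputs hw ?_ ?_
  · rw [hini, toProg, StackProg.run, h1]
    funext z
    cases z <;> simp [StackProg.run, enc]
  · have h4 := h3 u.length (fun q => Nat.zero_le _) (by simp [Tape.size])
    have h5 := hC u.length
    rw [hini, toProg, cost_seq, h1]
    have h6 : ((StackProg.drain .left).seq ((StackProg.drain .inp).seq (.move .out .res))).cost
        (enc (fun _ => 0) (fun _ => 0) t) =
        t.left.length + 1 + (t.inp.length + 1 + (t.out.length + 1)) := by
      simp [StackProg.cost, StackProg.run, enc]
    have h7 : t.left.length + t.inp.length ≤ u.length := by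
      simpa [Tape.size] using h2
    rw [h6]
    have h8 : (u.length + 1) ^ d ≤ (u.length + 1) ^ (d + 1) :=
      Nat.pow_le_pow_right (by omega) (by omega)
    have h9 : u.length + 1 ≤ (u.length + 1) ^ (d + 1) := Nat.le_self_pow (by omega) _
    have h10 : C * (u.length + 1) ^ d ≤ C * (u.length + 1) ^ (d + 1) := Nat.mul_le_mul_left _ h8
    simp only [List.length_nil] at h4
    rw [add_mul]
    omega

end Cmd

/-! ## The formula that expresses the existence of a plan -/

namespace TwoNormalized

/-- If the action `a` at time `i` requires a value `d`, and the action `b` at time `j` sets another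
value, then an action at a time in between sets `d`. Actions are numbered below `M`, the number
`E c` is the value set by `c`, and `i * M + a` is the variable for `a` taking place at time `i`. -/
def supportClause (M : ℕ) (E : ℕ → ℕ) (i a j b d : ℕ) : List Literal :=
  (false, i * M + a) :: (false, j * M + b) ::
    (List.range (i - j)).flatMap fun l => (List.range M).flatMap fun c =>
      if d ≤ E c then (if E c ≤ d then [(true, (j + l) * M + c)] else []) else []

/-- The formula for sequences of `T` actions out of `M`, the first one being `0` and the last one
being `1`, where `P a v` and `E a v` are the codes of the precondition and effect of the action `a`
at the variable `v < n`. -/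
def planFormula (T n M : ℕ) (P E : ℕ → ℕ → ℕ) : TwoNormalized :=
  ((List.range T).flatMap fun i => [(List.range M).flatMap fun a => [(true, i * M + a)]]) ++
  ([[(true, 0)], [(true, (T - 1) * M + 1)]] ++
  (List.range T).flatMap fun i => (List.range M).flatMap fun a => (List.range n).flatMap fun v =>
    if 1 ≤ P a v then
      (List.range i).flatMap fun j => (List.range M).flatMap fun b =>
        if 1 ≤ E b v then [supportClause M (fun c => E c v) i a j b (P a v)] else []
    else [])

/-- The word of a formula. -/
def word (φ : TwoNormalized) : List Bool := natsToWord φ.code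

/-- The word of a sequence of literals. -/
def litWord (C : List Literal) : List Bool := natsToWord (C.map litCode)

theorem word_append (φ ψ : TwoNormalized) : word (φ ++ ψ) = word φ ++ word ψ := by
  simp [word, code, natsToWord]

theorem word_flatMap {α : Type} (l : List α) (f : α → TwoNormalized) :
    word (l.flatMap f) = l.flatMap fun a => word (f a) := by
  simp [word, code, natsToWord, List.flatMap_assoc]

theorem word_singleton (C : List Literal) : word [C] = litWord C ++ [false] := by
  simp [word, code, natsToWord, litWord]

theorem litWord_cons (x : Literal) (C : List Literal) :
    litWord (x :: C) = List.replicate (litCode x) true ++ ([false] ++ litWord C) := by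
  simp [litWord, natsToWord]

theorem litWord_flatMap {α : Type} (l : List α) (f : α → List Literal) :
    litWord (l.flatMap f) = l.flatMap fun a => litWord (f a) := by
  simp [litWord, natsToWord, List.flatMap_assoc, List.map_flatMap]

end TwoNormalized

/-! ## The command that writes the formula -/

namespace Tape

/-- Reading only moves symbols across the reading position, so rewinding always recovers the input.
-/
theorem readAux_append (w l : List Bool) :
    (readAux w l).2.1.reverse ++ (readAux w l).2.2 = l.reverse ++ w := by
  induction w generalizing l with
  | nil => simp [readAux]
  | cons b w ih => cases b <;> simp [readAux, ih]

theorem rewind_next (t : Tape) : t.next.rewind = t.rewind := by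
  simp [next, rewind, readAux_append]

theorem rewind_iterate_next (k : ℕ) (t : Tape) : (next^[k] t).rewind = t.rewind := by
  induction k generalizing t with
  | zero => rfl
  | succ k ih => rw [Function.iterate_succ_apply, ih, rewind_next]

theorem readAux_natsToWord (n : ℕ) (ns : List ℕ) (l : List Bool) :
    (readAux (natsToWord (n :: ns)) l).1 = n ∧
      (readAux (natsToWord (n :: ns)) l).2.2 = natsToWord ns := by
  induction n generalizing l with
  | zero => simp [natsToWord, readAux]
  | succ n ih =>
    have h : natsToWord ((n + 1) :: ns) = true :: natsToWord (n :: ns) := by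
      simp [natsToWord, List.replicate_succ]
    rw [h, readAux]
    exact ⟨congrArg (· + 1) (ih _).1, (ih _).2⟩

/-- The default `0` agrees with the machine, which reads `0` on an exhausted input. -/
theorem val_iterate_next (k : ℕ) (ns : List ℕ) (l o : List Bool) :
    (next^[k] ⟨l, natsToWord ns, o⟩).val = ns.getD k 0 := by
  induction k generalizing l ns with
  | zero =>
    cases ns with
    | nil => rfl
    | cons n ns => exact (readAux_natsToWord n ns l).1
  | succ k ih =>
    rw [Function.iterate_succ_apply]
    cases ns with
    | nil => exact ih [] l
    | cons n ns =>
      rw [next, (readAux_natsToWord n ns l).2, ih]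
      simp

end Tape

namespace Cmd

open Function TwoNormalized

/-- The command writes `w` and leaves the input `W` at its start. -/
def Writes (W : List Bool) (p : Cmd) (e : Fin 32 → ℕ) (w : List Bool) : Prop :=
  ∀ o, p.den e ⟨[], W, o⟩ = ⟨[], W, w.reverse ++ o⟩

section Rules

variable {W : List Bool} {e : Fin 32 → ℕ}

theorem writes_emit (b : Bool) : Writes W (emit b) e [b] := fun _ => rfl

theorem Writes.seq {p q : Cmd} {u v : List Bool} (hp : Writes W p e u) (hq : Writes W q e v) :
    Writes W (seq p q) e (u ++ v) := by
  intro o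
  rw [den, hp, hq]
  simp

theorem writes_rep {q y : Fin 32} {p : Cmd} {w : ℕ → List Bool} {n : ℕ} (hn : n = e y)
    (h : ∀ i, Writes W p (update e q i) (w i)) :
    Writes W (rep q y p) e ((List.range n).flatMap w) := by
  subst hn
  intro o
  rw [den]
  generalize List.range (e y) = l
  induction l generalizing o with
  | nil => rfl
  | cons i l ih =>
    rw [List.foldl_cons, h, ih]
    simp

theorem writes_sub {q x y : Fin 32} {p : Cmd} {w : List Bool}
    (h : Writes W p (update e q (e x - e y)) w) : Writes W (sub q x y p) e w := h

theorem Writes.congr {p : Cmd} {u v : List Bool} (h : Writes W p e u) (huv : u = v) :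
    Writes W p e v := huv ▸ h

end Rules

/-- Run `p` if `x ≤ y`, with auxiliary registers `q₁`, `q₂`, `q₃`. -/
def ifLe (x y q₁ q₂ q₃ : Fin 32) (p : Cmd) : Cmd := sub q₁ x y (sub q₂ 0 q₁ (rep q₃ q₂ p))

/-- Register `0` holds `1`, and the truncated difference `1 - (x - y)` is `1` if `x ≤ y` and `0`
otherwise; it serves as the number of repetitions of `p`. -/
theorem writes_ifLe {W : List Bool} {e : Fin 32 → ℕ} {x y q₁ q₂ q₃ : Fin 32} {p : Cmd}
    {w : List Bool} {c : Prop} [Decidable c] (he : e 0 = 1) (hq : q₁ ≠ 0) (hc : c ↔ e x ≤ e y)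
    (h : ∀ i j k, Writes W p (update (update (update e q₁ i) q₂ j) q₃ k) w) :
    Writes W (ifLe x y q₁ q₂ q₃ p) e (if c then w else []) := by
  refine writes_sub (writes_sub ((writes_rep rfl fun i => h _ _ i).congr ?_))
  rw [update_self, update_self, update_of_ne (Ne.symm hq), he]
  split_ifs with hxy
  · rw [hc] at hxy
    simp [Nat.sub_eq_zero_of_le hxy]
  · rw [hc] at hxy
    have : 1 - (e x - e y) = 0 := by omega
    simp [this]

/-- Write `2 * x * M` ones, where `M` is the register `3`. -/
def emitMul (x q r : Fin 32) : Cmd := rep q x (rep r 3 (seq (emit true) (emit true)))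

theorem flatMap_range_replicate (n m : ℕ) :
    ((List.range n).flatMap fun _ => List.replicate m true) = List.replicate (n * m) true := by
  induction n with
  | zero => simp
  | succ n ih =>
    rw [List.range_succ, List.flatMap_append, ih]
    simp [add_mul]

theorem writes_emitMul {W : List Bool} {e : Fin 32 → ℕ} {x q r : Fin 32} (hq : q ≠ 3) :
    Writes W (emitMul x q r) e (List.replicate (2 * (e x * e 3)) true) := by
  refine (writes_rep rfl fun i => writes_rep rfl fun j =>
    (writes_emit true).seq (writes_emit true)).congr ?_
  have h : [true] ++ [true] = List.replicate 2 true := rfl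
  simp only [update_of_ne (Ne.symm hq), h, flatMap_range_replicate]
  congr 1
  ring

/-- Write `2 * a` ones. -/
def emitDouble (a q : Fin 32) : Cmd := rep q a (seq (emit true) (emit true))

theorem writes_emitDouble {W : List Bool} {e : Fin 32 → ℕ} {a q : Fin 32} :
    Writes W (emitDouble a q) e (List.replicate (2 * e a) true) := by
  refine (writes_rep rfl fun i => (writes_emit true).seq (writes_emit true)).congr ?_
  have h : [true] ++ [true] = List.replicate 2 true := rfl
  simp only [h, flatMap_range_replicate]
  congr 1
  ring

/-- Write the negation of the variable `x * M + a`. -/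
def emitNeg (x a q r : Fin 32) : Cmd :=
  seq (emitMul x q r) (seq (emitDouble a q) (seq (emit true) (emit false)))

/-- Write the variable `(x + y) * M + a`. -/
def emitPos (x y a q r : Fin 32) : Cmd :=
  seq (emitMul x q r) (seq (emitMul y q r)
    (seq (emitDouble a q) (seq (emit true) (seq (emit true) (emit false)))))

theorem writes_emitNeg {W : List Bool} {e : Fin 32 → ℕ} {x a q r : Fin 32} (hq : q ≠ 3) :
    Writes W (emitNeg x a q r) e
      (List.replicate (litCode (false, e x * e 3 + e a)) true ++ [false]) := by
  refine ((writes_emitMul hq).seq (writes_emitDouble.seq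
    ((writes_emit true).seq (writes_emit false)))).congr ?_
  have h : litCode (false, e x * e 3 + e a) = 2 * (e x * e 3) + (2 * e a + 1) := by
    simp [litCode]; ring
  simp [h, List.replicate_add]

theorem writes_emitPos {W : List Bool} {e : Fin 32 → ℕ} {x y a q r : Fin 32} (hq : q ≠ 3) :
    Writes W (emitPos x y a q r) e
      (List.replicate (litCode (true, (e x + e y) * e 3 + e a)) true ++ [false]) := by
  refine ((writes_emitMul hq).seq ((writes_emitMul hq).seq (writes_emitDouble.seq
    ((writes_emit true).seq ((writes_emit true).seq (writes_emit false)))))).congr ?_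
  have h : litCode (true, (e x + e y) * e 3 + e a) =
      2 * (e x * e 3) + (2 * (e y * e 3) + (2 * e a + 2)) := by
    simp [litCode]; ring
  simp [h, List.replicate_add]

/-! ### Locating entries of the instance -/

/-- The command moves the reading position by `k` numbers. -/
def Skips (p : Cmd) (e : Fin 32 → ℕ) (k : ℕ) : Prop := ∀ t, p.den e t = Tape.next^[k] t

theorem skips_skip {e : Fin 32 → ℕ} : Skips skip e 1 := fun _ => rfl

theorem Skips.seq {e : Fin 32 → ℕ} {p q : Cmd} {k m : ℕ} (hp : Skips p e k) (hq : Skips q e m) :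
    Skips (seq p q) e (k + m) := by
  intro t
  rw [den, hp, hq, add_comm, iterate_add_apply]

theorem skips_rep {e : Fin 32 → ℕ} {q y : Fin 32} {p : Cmd} {k : ℕ}
    (h : ∀ i, Skips p (update e q i) k) : Skips (rep q y p) e (e y * k) := by
  intro t
  rw [den]
  generalize e y = n
  induction n with
  | zero => simp
  | succ n ih =>
    rw [List.range_succ, List.foldl_append, ih, List.foldl_cons, List.foldl_nil, h,
      ← iterate_add_apply, add_mul, one_mul, add_comm]

theorem skips_sub {q x y : Fin 32} {e : Fin 32 → ℕ} {p : Cmd} {k : ℕ}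
    (h : Skips p (update e q (e x - e y)) k) : Skips (sub q x y p) e k := h

/-- Skip `a * n` numbers, where `n` is the register `2`. -/
def skipMul (a q r : Fin 32) : Cmd := rep q a (rep r 2 skip)

theorem skips_skipMul {e : Fin 32 → ℕ} {a q r : Fin 32} (hq : q ≠ 2) :
    Skips (skipMul a q r) e (e a * e 2) := by
  refine skips_rep fun i => ?_
  have := skips_rep (e := update e q i) (q := r) (y := 2) fun j => skips_skip
  rwa [update_of_ne (Ne.symm hq), mul_one] at this

/-- Skip the blocks before the precondition of the action `a`. -/
def skipPre (a q₁ q₂ q₃ q₄ : Fin 32) : Cmd :=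
  seq (skipMul a q₁ q₂) (sub q₁ a 0 (sub q₂ q₁ 0 (skipMul q₂ q₃ q₄)))

/-- Skip the blocks before the effect of the action `a`. -/
def skipEff (a q₁ q₂ q₃ : Fin 32) : Cmd :=
  seq (skipMul a q₁ q₂) (sub q₁ a 0 (skipMul q₁ q₂ q₃))

/-- After the header come the blocks initial state, goal, then precondition and effect of each
original action. The action `b + 2` of the extended instance has its precondition in block `2 * b +
2`, that is `a + (a - 2)` for `a = b + 2`; truncation sends the actions `0` and `1` to the blocks of
the initial state and of the goal. For effects, `a + (a - 1)` works in the same way. -/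
theorem skips_skipPre {e : Fin 32 → ℕ} {a q₁ q₂ q₃ q₄ : Fin 32} (he : e 0 = 1) (h₁ : q₁ ≠ 2)
    (h₂ : q₂ ≠ 2) (h₃ : q₃ ≠ 2) (h₄ : q₁ ≠ 0) :
    Skips (skipPre a q₁ q₂ q₃ q₄) e ((e a + (e a - 2)) * e 2) := by
  have h := (skips_skipMul (e := e) (a := a) (r := q₂) h₁).seq (skips_sub (q := q₁) (x := a)
    (y := 0) (skips_sub (q := q₂) (x := q₁) (y := 0) (skips_skipMul (a := q₂) (r := q₄) h₃)))
  rw [update_self, update_self, update_of_ne (Ne.symm h₂), update_of_ne (Ne.symm h₁),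
    update_of_ne (Ne.symm h₄), he, ← add_mul] at h
  exact h

theorem skips_skipEff {e : Fin 32 → ℕ} {a q₁ q₂ q₃ : Fin 32} (he : e 0 = 1) (h₁ : q₁ ≠ 2)
    (h₂ : q₂ ≠ 2) : Skips (skipEff a q₁ q₂ q₃) e ((e a + (e a - 1)) * e 2) := by
  have h := (skips_skipMul (e := e) (a := a) (r := q₂) h₁).seq (skips_sub (q := q₁) (x := a)
    (y := 0) (skips_skipMul (a := q₁) (r := q₃) h₂))
  rw [update_self, update_of_ne (Ne.symm h₁), he, ← add_mul] at h
  exact h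

/-- Read the entry for the variable `v` of the block found by `pos` into the register `d`. -/
def fetch (d v : Fin 32) (pos p : Cmd) : Cmd :=
  seq skip (seq skip (seq skip (seq skip (seq (rep d v skip) (seq pos (read d (seq rewind p)))))))

/-- The `4` counts the header: `k` and the numbers of variables, values and actions. The rewind
before `p` makes each access independent of the previous ones. -/
theorem writes_fetch {ns : List ℕ} {e : Fin 32 → ℕ} {d v : Fin 32} {pos p : Cmd} {k : ℕ}
    {w : List Bool} (hpos : Skips pos e k)
    (h : Writes (natsToWord ns) p (update e d (ns.getD (4 + e v + k) 0)) w) :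
    Writes (natsToWord ns) (fetch d v pos p) e w := by
  intro o
  have hs : Skips (seq skip (seq skip (seq skip (seq skip (seq (rep d v skip) pos))))) e
      (4 + e v + k) := by
    have := skips_skip.seq (skips_skip.seq (skips_skip.seq (skips_skip.seq
      ((skips_rep (q := d) (y := v) fun i => skips_skip).seq hpos))))
    have hk : 1 + (1 + (1 + (1 + (e v * 1 + k)))) = 4 + e v + k := by ring
    rwa [hk] at this
  have h1 := hs ⟨[], natsToWord ns, o⟩
  simp only [den] at h1
  simp only [fetch, den]
  rw [h1, Tape.val_iterate_next, Tape.rewind_next, Tape.rewind_iterate_next]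
  exact h o

/-- Write the literals of a support clause for actions that set the value required. -/
def emitSupport : Cmd :=
  sub 17 4 11 (rep 18 17 (rep 19 3 (fetch 20 6 (skipEff 19 20 21 22)
    (ifLe 7 20 21 22 23 (ifLe 20 7 24 25 26 (emitPos 11 18 19 27 28))))))

/-- Write the support clause for given actions. -/
def emitClause : Cmd :=
  seq (emitNeg 4 5 17 18) (seq (emitNeg 11 12 17 18) (seq emitSupport (emit false)))

/-- Write all support clauses. -/
def emitClauses : Cmd :=
  rep 4 1 (rep 5 3 (rep 6 2 (fetch 7 6 (skipPre 5 7 8 9 10) (ifLe 0 7 8 9 10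
    (rep 11 4 (rep 12 3 (fetch 13 6 (skipEff 12 13 14 15) (ifLe 0 13 14 15 16 emitClause))))))))

/-- Write the clauses that require some action at each time. -/
def emitChoices : Cmd :=
  sub 4 0 0 (rep 5 1 (seq (rep 6 3 (emitPos 5 4 6 7 8)) (emit false)))

/-- Write the clauses on the first and last action. -/
def emitEnds : Cmd :=
  sub 4 0 0 (seq (seq (emitPos 4 4 4 5 6) (emit false))
    (sub 5 1 0 (seq (emitPos 5 4 0 6 7) (emit false))))

/-- Write the instance, where the registers `0`, `1`, `2`, `3` are `1`, the number of times, the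
number of variables and the number of actions. -/
def emitInstance : Cmd :=
  seq (seq (rep 4 1 (emit true)) (emit false)) (seq emitChoices (seq emitEnds emitClauses))

/-- Read the parameters and write the instance. -/
def reduction : Cmd :=
  read 1 (inc 1 (inc 1 (read 2 (seq skip (read 3 (inc 3 (inc 3 (inc 0
    (seq rewind emitInstance)))))))))

theorem reduction_ok : ok 1 reduction = true := by decide +kernel

theorem reduction_wellFormed : reduction.toProg.WellFormed = true := by decide +kernel

/-- The entry of the effect of an action in an instance given as a sequence of numbers. -/
def effEntry (ns : List ℕ) (n a v : ℕ) : ℕ := ns.getD (4 + v + (a + (a - 1)) * n) 0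

/-- The entry of the precondition of an action in an instance given as a sequence of numbers. -/
def preEntry (ns : List ℕ) (n a v : ℕ) : ℕ := ns.getD (4 + v + (a + (a - 2)) * n) 0

theorem word_ite (c : Prop) [Decidable c] (φ : TwoNormalized) :
    word (if c then φ else []) = if c then word φ else [] := by
  split_ifs <;> rfl

theorem litWord_ite (c : Prop) [Decidable c] (C : List Literal) :
    litWord (if c then C else []) = if c then litWord C else [] := by
  split_ifs <;> rfl

/-- Registers `4`, `5`, `6`, `7` hold `i`, `a`, `v` and the required value `d`, while `11` and `12`
hold `j` and `b`. The gaps are scratch registers of `ifLe`; two tests `≤` together express equality.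
-/
theorem writes_emitSupport {ns : List ℕ} {e : Fin 32 → ℕ} (he : e 0 = 1) :
    Writes (natsToWord ns) emitSupport e (litWord ((List.range (e 4 - e 11)).flatMap fun l =>
      (List.range (e 3)).flatMap fun c => if e 7 ≤ effEntry ns (e 2) c (e 6) then
        (if effEntry ns (e 2) c (e 6) ≤ e 7 then [(true, (e 11 + l) * e 3 + c)] else [])
        else [])) := by
  unfold emitSupport
  refine writes_sub ?_
  rw [litWord_flatMap]
  refine writes_rep (by simp) fun l => ?_
  rw [litWord_flatMap]
  refine writes_rep (by simp) fun c => ?_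
  refine writes_fetch (skips_skipEff (by simpa using he) (by decide) (by decide)) ?_
  rw [litWord_ite]
  refine writes_ifLe (by simpa using he) (by decide) (by simp [effEntry]) fun _ _ _ => ?_
  rw [litWord_ite]
  refine writes_ifLe (by simpa using he) (by decide) (by simp [effEntry]) fun _ _ _ => ?_
  refine (writes_emitPos (by decide)).congr ?_
  simp [litWord, natsToWord]

theorem writes_emitClause {ns : List ℕ} {e : Fin 32 → ℕ} (he : e 0 = 1) :
    Writes (natsToWord ns) emitClause e (word [supportClause (e 3)
      (fun c => effEntry ns (e 2) c (e 6)) (e 4) (e 5) (e 11) (e 12) (e 7)]) := by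
  refine ((writes_emitNeg (by decide)).seq ((writes_emitNeg (by decide)).seq
    ((writes_emitSupport he).seq (writes_emit false)))).congr ?_
  simp [word_singleton, supportClause, litWord_cons]

theorem writes_emitClauses {ns : List ℕ} {e : Fin 32 → ℕ} (he : e 0 = 1) :
    Writes (natsToWord ns) emitClauses e (word
      ((List.range (e 1)).flatMap fun i => (List.range (e 3)).flatMap fun a =>
        (List.range (e 2)).flatMap fun v => if 1 ≤ preEntry ns (e 2) a v then
          (List.range i).flatMap fun j => (List.range (e 3)).flatMap fun b =>
            if 1 ≤ effEntry ns (e 2) b v then [supportClause (e 3)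
              (fun c => effEntry ns (e 2) c v) i a j b (preEntry ns (e 2) a v)] else []
        else [])) := by
  unfold emitClauses
  rw [word_flatMap]
  refine writes_rep rfl fun i => ?_
  rw [word_flatMap]
  refine writes_rep (by simp) fun a => ?_
  rw [word_flatMap]
  refine writes_rep (by simp) fun v => ?_
  refine writes_fetch (skips_skipPre (by simpa using he) (by decide) (by decide) (by decide)
    (by decide)) ?_
  rw [word_ite]
  refine writes_ifLe (by simpa using he) (by decide) (by simp [preEntry, he]) fun _ _ _ => ?_
  rw [word_flatMap]
  refine writes_rep (by simp) fun j => ?_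
  rw [word_flatMap]
  refine writes_rep (by simp) fun b => ?_
  refine writes_fetch (skips_skipEff (by simpa using he) (by decide) (by decide)) ?_
  rw [word_ite]
  refine writes_ifLe (by simpa using he) (by decide) (by simp [effEntry, he]) fun _ _ _ => ?_
  refine (writes_emitClause (by simpa using he)).congr ?_
  simp [preEntry]

theorem writes_emitChoices {W : List Bool} {e : Fin 32 → ℕ} :
    Writes W emitChoices e (word
      ((List.range (e 1)).flatMap fun i => [(List.range (e 3)).flatMap fun a =>
        [(true, i * e 3 + a)]])) := by
  unfold emitChoices
  refine writes_sub ?_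
  rw [word_flatMap]
  refine writes_rep (by simp) fun i => ?_
  rw [word_singleton, litWord_flatMap]
  refine Writes.seq (writes_rep (by simp) fun a => ?_) (writes_emit false)
  refine (writes_emitPos (by decide)).congr ?_
  simp [litWord, natsToWord]

/-- Register `4` is set to `1 - 1 = 0` and gives time and action `0`; the constant `1` in register
`0` doubles as the number of the goal action. -/
theorem writes_emitEnds {W : List Bool} {e : Fin 32 → ℕ} (he : e 0 = 1) :
    Writes W emitEnds e (word [[(true, 0)], [(true, (e 1 - 1) * e 3 + 1)]]) := by
  refine (writes_sub (((writes_emitPos (by decide)).seq (writes_emit false)).seq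
    (writes_sub ((writes_emitPos (by decide)).seq (writes_emit false))))).congr ?_
  have h : ∀ C D : List Literal, [C, D] = [C] ++ [D] := fun _ _ => rfl
  rw [h, word_append, word_singleton, word_singleton]
  simp [he, litWord, natsToWord]

theorem writes_emitInstance {ns : List ℕ} {e : Fin 32 → ℕ} (he : e 0 = 1) :
    Writes (natsToWord ns) emitInstance e (natsToWord (e 1 :: (planFormula (e 1) (e 2) (e 3)
      (preEntry ns (e 2)) (effEntry ns (e 2))).code)) := by
  refine (((writes_rep rfl fun i => writes_emit true).seq (writes_emit false)).seq
    (writes_emitChoices.seq ((writes_emitEnds he).seq (writes_emitClauses he)))).congr ?_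
  have h := flatMap_range_replicate (e 1) 1
  rw [List.replicate_one, mul_one] at h
  have h' : ∀ φ : TwoNormalized, natsToWord (e 1 :: φ.code) =
      (List.replicate (e 1) true ++ [false]) ++ word φ := by
    intro φ
    simp [word, natsToWord]
  rw [h', planFormula, word_append, word_append, h]

/-- The domain size `d` is skipped: the formula only compares codes of values. The two additional
times and actions come from the `inc` commands. -/
theorem reduction_den (k n d m : ℕ) (ns : List ℕ) :
    (reduction.den (fun _ => 0) ⟨[], natsToWord (k :: n :: d :: m :: ns), []⟩).out.reverse =
      natsToWord ((k + 2) :: (planFormula (k + 2) n (m + 2)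
        (preEntry (k :: n :: d :: m :: ns) n) (effEntry (k :: n :: d :: m :: ns) n)).code) := by
  have hv : ∀ i, (Tape.next^[i] ⟨[], natsToWord (k :: n :: d :: m :: ns), []⟩).val =
      (k :: n :: d :: m :: ns).getD i 0 := fun i => Tape.val_iterate_next _ _ _ _
  have h0 := hv 0
  have h1 := hv 1
  have h3 := hv 3
  simp only [iterate_succ_apply, iterate_zero_apply, List.getD_cons_zero, List.getD_cons_succ]
    at h0 h1 h3
  simp only [reduction, den, h0, h1, h3, Tape.rewind_next]
  simp only [Tape.rewind, List.reverse_nil, List.nil_append]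
  rw [writes_emitInstance (by simp)]
  simp

end Cmd

/-! ## Satisfying assignments and sequences of actions -/

namespace TwoNormalized

theorem holds_append {φ ψ : TwoNormalized} {S : Finset ℕ} :
    Holds (φ ++ ψ) S ↔ Holds φ S ∧ Holds ψ S := by
  simp only [Holds, List.mem_append, or_imp, forall_and]

theorem holds_flatMap {α : Type} {l : List α} {f : α → TwoNormalized} {S : Finset ℕ} :
    Holds (l.flatMap f) S ↔ ∀ a ∈ l, Holds (f a) S := by
  simp only [Holds, List.mem_flatMap]
  exact ⟨fun h a ha C hC => h C ⟨a, ha, hC⟩, fun h C ⟨a, ha, hC⟩ => h a ha C hC⟩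

theorem holds_singleton {C : List Literal} {S : Finset ℕ} :
    Holds [C] S ↔ ∃ l ∈ C, (l.2 ∈ S ↔ l.1 = true) := by
  simp [Holds]

/-- The variables that are true when the actions `α 0, …, α (T - 1)` take place. -/
def actionVars (T M : ℕ) (α : ℕ → ℕ) : Finset ℕ :=
  (Finset.range T).image fun i => i * M + α i

/-- Whenever an action requires a value, and an earlier action sets the variable, then the value is
set by that action or a later one. -/
def Supported (T n : ℕ) (P E : ℕ → ℕ → ℕ) (α : ℕ → ℕ) : Prop :=
  ∀ i < T, ∀ v < n, 1 ≤ P (α i) v → ∀ j < i, 1 ≤ E (α j) v →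
    ∃ l, j ≤ l ∧ l < i ∧ E (α l) v = P (α i) v

section

variable {T n M : ℕ} {P E : ℕ → ℕ → ℕ} {α : ℕ → ℕ}

theorem mul_add_inj {i j a b : ℕ} (ha : a < M) (hb : b < M) :
    i * M + a = j * M + b ↔ i = j ∧ a = b := by
  refine ⟨fun h => ?_, fun ⟨h1, h2⟩ => by rw [h1, h2]⟩
  have h1 : (i * M + a) / M = i := by
    rw [mul_comm, Nat.mul_add_div (by omega), Nat.div_eq_of_lt ha, add_zero]
  have h2 : (j * M + b) / M = j := by
    rw [mul_comm, Nat.mul_add_div (by omega), Nat.div_eq_of_lt hb, add_zero]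
  have h3 : i = j := by rw [← h1, h, h2]
  subst h3
  exact ⟨rfl, by omega⟩

theorem mem_actionVars (hα : ∀ i < T, α i < M) {i a : ℕ} (ha : a < M) :
    i * M + a ∈ actionVars T M α ↔ i < T ∧ α i = a := by
  simp only [actionVars, Finset.mem_image, Finset.mem_range]
  constructor
  · rintro ⟨j, hj, h⟩
    obtain ⟨rfl, rfl⟩ := (mul_add_inj (hα j hj) ha).1 h
    exact ⟨hj, rfl⟩
  · rintro ⟨h, rfl⟩
    exact ⟨i, h, rfl⟩

theorem card_actionVars (hα : ∀ i < T, α i < M) : (actionVars T M α).card = T := by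
  rw [actionVars, Finset.card_image_of_injOn, Finset.card_range]
  intro i hi j hj h
  exact ((mul_add_inj (hα i (by simpa using hi)) (hα j (by simpa using hj))).1 h).1

theorem mem_supportClause {e : ℕ → ℕ} {i a j b d : ℕ} {x : Literal} :
    x ∈ supportClause M e i a j b d ↔ x = (false, i * M + a) ∨ x = (false, j * M + b) ∨
      ∃ l < i - j, ∃ c < M, e c = d ∧ x = (true, (j + l) * M + c) := by
  simp only [supportClause, List.mem_cons, List.mem_flatMap, List.mem_range]
  refine or_congr_right (or_congr_right (exists_congr fun l => and_congr_right fun _ =>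
    exists_congr fun c => and_congr_right fun _ => ?_))
  split_ifs with h1 h2
  · simp [le_antisymm h2 h1]
  · simp; omega
  · simp; omega

/-- A support clause can only fail if its two negative literals do, that is, if `a = α i` and `b = α
j`; what remains of it is the condition in `Supported`. -/
theorem holds_planFormula (hT : 1 ≤ T) (hM : 2 ≤ M) (hα : ∀ i < T, α i < M) :
    Holds (planFormula T n M P E) (actionVars T M α) ↔
      α 0 = 0 ∧ α (T - 1) = 1 ∧ Supported T n P E α := by
  have hmem : ∀ {i a : ℕ}, a < M → (i * M + a ∈ actionVars T M α ↔ i < T ∧ α i = a) :=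
    fun ha => mem_actionVars hα ha
  have hends : Holds [[(true, 0)], [(true, (T - 1) * M + 1)]] (actionVars T M α) ↔
      α 0 = 0 ∧ α (T - 1) = 1 := by
    have h0 := hmem (i := 0) (a := 0) (by omega)
    have h1 := hmem (i := T - 1) (a := 1) (by omega)
    rw [zero_mul, zero_add] at h0
    simp only [Holds, List.mem_cons, List.not_mem_nil, or_false, forall_eq_or_imp, forall_eq,
      exists_eq_left, iff_true, h0, h1]
    refine and_congr ⟨fun h => h.2, fun h => ⟨by omega, h⟩⟩
      ⟨fun h => h.2, fun h => ⟨by omega, h⟩⟩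
  have hchoice : Holds ((List.range T).flatMap fun i =>
      [(List.range M).flatMap fun a => [((true, i * M + a) : Literal)]]) (actionVars T M α) := by
    rw [holds_flatMap]
    intro i hi
    rw [holds_singleton]
    rw [List.mem_range] at hi
    exact ⟨(true, i * M + α i), by simpa using hα i hi,
      by simpa using (hmem (hα i hi)).2 ⟨hi, rfl⟩⟩
  rw [planFormula, holds_append, holds_append, hends, and_assoc]
  refine ⟨fun ⟨_, h0, h1, h⟩ => ⟨h0, h1, ?_⟩, fun ⟨h0, h1, h⟩ => ⟨hchoice, h0, h1, ?_⟩⟩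
  · intro i hi v hv hP j hj hE
    have hjT : j < T := by omega
    have h := holds_flatMap.1 h i (List.mem_range.2 hi)
    have h := holds_flatMap.1 h (α i) (List.mem_range.2 (hα i hi))
    have h := holds_flatMap.1 h v (List.mem_range.2 hv)
    rw [if_pos hP] at h
    have h := holds_flatMap.1 h j (List.mem_range.2 hj)
    have h := holds_flatMap.1 h (α j) (List.mem_range.2 (hα j hjT))
    rw [if_pos hE, holds_singleton] at h
    obtain ⟨x, hx, hxS⟩ := h
    rcases mem_supportClause.1 hx with rfl | rfl | ⟨l, hl, c, hc, hcE, rfl⟩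
    · simp [(hmem (hα i hi)).2 ⟨hi, rfl⟩] at hxS
    · simp [(hmem (hα j hjT)).2 ⟨hjT, rfl⟩] at hxS
    · have := (hmem hc).1 (hxS.2 rfl)
      exact ⟨j + l, by omega, by omega, by rw [this.2, hcE]⟩
  · refine holds_flatMap.2 fun i hi => holds_flatMap.2 fun a ha => holds_flatMap.2 fun v hv => ?_
    rw [List.mem_range] at hi ha hv
    split_ifs with hP
    swap
    · simp [Holds]
    refine holds_flatMap.2 fun j hj => holds_flatMap.2 fun b hb => ?_
    rw [List.mem_range] at hj hb
    split_ifs with hE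
    swap
    · simp [Holds]
    rw [holds_singleton]
    by_cases hia : α i = a
    swap
    · exact ⟨_, mem_supportClause.2 (.inl rfl), by simp [hmem ha, hia]⟩
    by_cases hjb : α j = b
    swap
    · exact ⟨_, mem_supportClause.2 (.inr (.inl rfl)), by simp [hmem hb, hjb]⟩
    subst hia hjb
    obtain ⟨l, hjl, hli, hl⟩ := h i hi v hv hP j hj hE
    have hlT : l < T := by omega
    refine ⟨(true, l * M + α l), mem_supportClause.2 (.inr (.inr ⟨l - j, by omega, α l, hα l hlT,
      hl, ?_⟩)), ?_⟩
    · rw [Nat.add_sub_cancel' hjl]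
    · simp [hmem (hα l hlT), hlT]

/-- The weight replaces at-most-one clauses: picking a true variable for each time gives `T`
distinct elements of `S`, hence all of `S`. -/
theorem satisfiable_planFormula (hT : 1 ≤ T) (hM : 2 ≤ M) :
    (∃ S ⊆ vars (planFormula T n M P E), S.card = T ∧ Holds (planFormula T n M P E) S) ↔
      ∃ α : ℕ → ℕ, (∀ i, α i < M) ∧ α 0 = 0 ∧ α (T - 1) = 1 ∧ Supported T n P E α := by
  constructor
  · rintro ⟨S, -, hcard, hS⟩
    have h : ∀ i, ∃ a < M, i < T → i * M + a ∈ S := by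
      intro i
      by_cases hi : i < T
      · rw [planFormula, holds_append] at hS
        have := holds_flatMap.1 hS.1 i (List.mem_range.2 hi)
        rw [holds_singleton] at this
        obtain ⟨x, hx, hxS⟩ := this
        simp only [List.mem_flatMap, List.mem_range, List.mem_singleton] at hx
        obtain ⟨a, ha, rfl⟩ := hx
        exact ⟨a, ha, fun _ => hxS.2 rfl⟩
      -- Times from `T` on are irrelevant; any action will do.
      · exact ⟨0, by omega, fun h => absurd h hi⟩
    choose α hα hαS using h
    have hSα : actionVars T M α = S := by
      refine Finset.eq_of_subset_of_card_le ?_ ?_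
      · intro x hx
        simp only [actionVars, Finset.mem_image, Finset.mem_range] at hx
        obtain ⟨i, hi, rfl⟩ := hx
        exact hαS i hi
      · rw [hcard, card_actionVars fun i _ => hα i]
    rw [← hSα, holds_planFormula hT hM fun i _ => hα i] at hS
    exact ⟨α, hα, hS⟩
  · rintro ⟨α, hα, h⟩
    refine ⟨actionVars T M α, ?_, card_actionVars fun i _ => hα i,
      (holds_planFormula hT hM fun i _ => hα i).2 h⟩
    intro x hx
    simp only [actionVars, Finset.mem_image, Finset.mem_range] at hx
    obtain ⟨i, hi, rfl⟩ := hx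
    simp only [vars, List.mem_toFinset, List.mem_map, List.mem_flatten]
    -- Each variable used occurs in the choice clause of its time.
    refine ⟨(true, i * M + α i), ⟨(List.range M).flatMap fun a => [(true, i * M + a)], ?_, ?_⟩, rfl⟩
    · rw [planFormula]
      exact List.mem_append_left _ (List.mem_flatMap.2 ⟨i, List.mem_range.2 hi, by simp⟩)
    · simpa using hα i

/-! ### Support clauses and the last value set -/

/-- The value of a variable before time `i`, if every action sets the values that are positive. -/
def lastValue (e : ℕ → ℕ) : ℕ → ℕ
  | 0 => 0
  | i + 1 => if 1 ≤ e i then e i else lastValue e i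

/-- Apply the right side to the last `j` with `1 ≤ e j`, which exists by `h0`: no later index
carries a positive value, so `l = j`. In the induction, either the newest index is this `j`, or it
has value `0` and is irrelevant. -/
theorem lastValue_eq_iff {e : ℕ → ℕ} (h0 : 1 ≤ e 0) {d : ℕ} (hd : 1 ≤ d) (i : ℕ) :
    lastValue e (i + 1) = d ↔ ∀ j < i + 1, 1 ≤ e j → ∃ l, j ≤ l ∧ l < i + 1 ∧ e l = d := by
  induction i with
  | zero =>
    rw [lastValue, if_pos h0]
    constructor
    · intro h j hj _
      exact ⟨0, by omega, by omega, h⟩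
    · intro h
      obtain ⟨l, -, hl, h⟩ := h 0 (by omega) h0
      obtain rfl : l = 0 := by omega
      exact h
  | succ i ih =>
    rw [lastValue]
    split_ifs with hi
    · constructor
      · intro h j hj _
        exact ⟨i + 1, by omega, by omega, h⟩
      · intro h
        obtain ⟨l, hl, hl', h⟩ := h (i + 1) (by omega) hi
        obtain rfl : l = i + 1 := by omega
        exact h
    · rw [ih]
      constructor
      · intro h j hj hej
        have : j ≠ i + 1 := by rintro rfl; exact hi hej
        obtain ⟨l, hl, hl', h⟩ := h j (by omega) hej
        exact ⟨l, hl, by omega, h⟩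
      · intro h j hj hej
        obtain ⟨l, hl, hl', h⟩ := h j (by omega) hej
        have : l ≠ i + 1 := by rintro rfl; omega
        exact ⟨l, hl, by omega, h⟩

/-- Time `0` drops out, since no earlier action could violate a requirement there. -/
theorem supported_iff (h0 : ∀ v < n, 1 ≤ E (α 0) v) :
    Supported T n P E α ↔ ∀ i, i + 1 < T → ∀ v < n, 1 ≤ P (α (i + 1)) v →
      lastValue (fun j => E (α j) v) (i + 1) = P (α (i + 1)) v := by
  constructor
  · intro h i hi v hv hP
    exact (lastValue_eq_iff (h0 v hv) hP i).2 (h (i + 1) hi v hv hP)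
  · intro h i hi v hv hP
    cases i with
    | zero => intro j hj; omega
    | succ i => exact (lastValue_eq_iff (h0 v hv) hP i).1 (h i hi v hv hP)

end

end TwoNormalized

/-! ## Sequences of actions and plans -/

namespace SASInstance

variable {V D : Type} {m : ℕ}

/-- The instance with two more actions: `0`, whose precondition and effect are the initial state,
and `1`, whose precondition and effect are the goal. -/
def extend (P : SASInstance V D (Fin m)) : SASInstance V D (Fin (m + 2)) where
  init := P.init
  goal := P.goal
  pre := Matrix.vecCons (fun v => some (P.init v)) (Matrix.vecCons P.goal P.pre)
  eff := Matrix.vecCons (fun v => some (P.init v)) (Matrix.vecCons P.goal P.eff)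

/-- The states passed through by a sequence of actions. -/
def states {A : Type} (P : SASInstance V D A) (α : ℕ → A) : ℕ → V → D
  | 0 => P.init
  | i + 1 => P.result (α i) (P.states α i)

theorem isPlanFromTo_append {A : Type} (P : SASInstance V D A) (p q : List A) (s t u : V → D)
    (hp : P.IsPlanFromTo p s t) (hq : P.IsPlanFromTo q t u) : P.IsPlanFromTo (p ++ q) s u := by
  induction p generalizing s with
  | nil => cases hp; exact hq
  | cons a p ih => exact ⟨hp.1, ih _ hp.2⟩

/-- This makes both additional actions idle wherever they are valid. -/
theorem result_eq_self {A : Type} (P : SASInstance V D A) {a : A} (ha : P.eff a = P.pre a)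
    {s : V → D} (h : P.Valid a s) : P.result a s = s := by
  funext v
  rw [result, ha]
  rcases h v with h | h <;> simp [h]

theorem exists_plan_iff (P : SASInstance V D (Fin m)) (k : ℕ) :
    (∃ p : List (Fin m), p.length ≤ k ∧ P.IsPlan p) ↔
      ∃ α : ℕ → Fin (m + 2), α 0 = 0 ∧ α (k + 1) = 1 ∧
        ∀ i < k + 2, P.extend.Valid (α i) (P.extend.states α i) := by
  have hinit : P.extend.result 0 P.init = P.init := rfl
  constructor
  · rintro ⟨p, hpk, s, hs, hp⟩
    -- The action `0`, then the plan with its actions renumbered by two, then `1` forever.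
    let α : ℕ → Fin (m + 2) := fun i => i.casesOn 0 fun j =>
      if h : j < p.length then p[j].succ.succ else 1
    have hα : ∀ j, α (j + 1) = if h : j < p.length then p[j].succ.succ else 1 := fun _ => rfl
    have key : ∀ j ≤ p.length, P.IsPlanFromTo (p.drop j) (P.extend.states α (j + 1)) s := by
      intro j
      induction j with
      | zero => intro _; exact hp
      | succ j ih =>
        intro hj
        have h := ih (by omega)
        rw [List.drop_eq_getElem_cons (by omega)] at h
        rw [states, hα, dif_pos (by omega)]
        exact h.2
    have hgoal : ∀ j, P.extend.states α (p.length + j + 1) = s := by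
      intro j
      induction j with
      | zero =>
        have h := key p.length le_rfl
        rw [List.drop_length] at h
        exact h
      | succ j ih =>
        rw [← add_assoc, states, ih, hα, dif_neg (by omega)]
        exact P.extend.result_eq_self (a := 1) rfl hs
    refine ⟨α, rfl, ?_, ?_⟩
    · rw [hα, dif_neg (by omega)]
    · intro i _
      cases i with
      | zero => exact fun v => .inl rfl
      | succ j =>
        rw [hα]
        split_ifs with hj
        · have h := key j hj.le
          rw [List.drop_eq_getElem_cons hj] at h
          exact h.1
        · have h := hgoal (j - p.length)
          rw [Nat.add_sub_cancel' (by omega)] at h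
          rw [h]
          exact hs
  · rintro ⟨α, h0, h1, h⟩
    -- Collect the original actions among times `1, …, j`: each time contributes at most one, and
    -- the additional actions leave the state unchanged. Time `k + 1` is excluded because its action
    -- `1` only tests the goal.
    have key : ∀ j < k + 1, ∃ p : List (Fin m), p.length ≤ j ∧
        P.IsPlanFromTo p P.init (P.extend.states α (j + 1)) := by
      intro j
      induction j with
      | zero =>
        intro _
        refine ⟨[], le_rfl, ?_⟩
        rw [states, h0]
        exact hinit.symm
      | succ j ih =>
        intro hj
        obtain ⟨p, hpj, hp⟩ := ih (by omega)
        have hv := h (j + 1) (by omega)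
        rw [states]
        generalize α (j + 1) = a at hv ⊢
        refine Fin.cases (fun hv => ?_) (fun a => ?_) a hv
        · refine ⟨p, by omega, ?_⟩
          rwa [P.extend.result_eq_self (a := 0) rfl hv]
        · refine Fin.cases (fun hv => ?_) (fun a hv => ?_) a
          · refine ⟨p, by omega, ?_⟩
            rwa [P.extend.result_eq_self (a := Fin.succ 0) rfl hv]
          · exact ⟨p ++ [a], by simpa using hpj,
              P.isPlanFromTo_append p [a] _ _ _ hp ⟨hv, rfl⟩⟩
    obtain ⟨p, hpk, hp⟩ := key k (by omega)
    refine ⟨p, hpk, _, ?_, hp⟩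
    have hv := h (k + 1) (by omega)
    rw [h1] at hv
    exact hv

end SASInstance

/-! ## The reduction -/

namespace BoundedSASInstance

open TwoNormalized Cmd

theorem getD_flatMap {α : Type} (F : α → List ℕ) (L : ℕ) (hF : ∀ a, (F a).length = L)
    (l : List α) (i : ℕ) (hi : i < l.length) (w : ℕ) (hw : w < L) :
    (l.flatMap F).getD (i * L + w) 0 = (F l[i]).getD w 0 := by
  induction l generalizing i with
  | nil => simp at hi
  | cons a l ih =>
    rw [List.flatMap_cons]
    cases i with
    | zero =>
      rw [zero_mul, zero_add, List.getD_append _ _ _ _ (by rw [hF]; exact hw)]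
      rfl
    | succ i =>
      have h : (i + 1) * L + w = L + (i * L + w) := by ring
      rw [List.getD_append_right _ _ _ _ (by rw [hF, h]; omega), hF, h, Nat.add_sub_cancel_left,
        ih i (by simpa using hi)]
      rfl

theorem getD_ofFn {n : ℕ} (f : Fin n → ℕ) (v : Fin n) : (List.ofFn f).getD v 0 = f v := by
  simp

variable (I : BoundedSASInstance)

theorem code_entry_init (v : Fin I.numVars) :
    I.code.getD (4 + v) 0 = valCode (some (I.plan.init v)) := by
  rw [code, add_comm]
  simp only [List.getD_cons_succ]
  rw [List.getD_append _ _ _ _ (by simp), getD_ofFn]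

theorem code_entry_goal (v : Fin I.numVars) :
    I.code.getD (4 + v + I.numVars) 0 = valCode (I.plan.goal v) := by
  have h : 4 + v + I.numVars = I.numVars + v + 4 := by ring
  rw [code, h]
  simp only [List.getD_cons_succ]
  rw [List.getD_append_right _ _ _ _ (by simp), List.length_ofFn, Nat.add_sub_cancel_left,
    List.getD_append _ _ _ _ (by simp), getD_ofFn]

/-- The offset `(2 * a + 2) * I.numVars` passes the initial state, the goal and the two blocks of
each earlier action; `w` ranges over the precondition and the effect of `a` together. -/
theorem code_entry_action (a : Fin I.numActs) (w : ℕ) (hw : w < 2 * I.numVars) :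
    I.code.getD (4 + w + (2 * a + 2) * I.numVars) 0 =
      (List.ofFn (fun v => valCode (I.plan.pre a v)) ++
        List.ofFn (fun v => valCode (I.plan.eff a v))).getD w 0 := by
  have h : 4 + w + (2 * a + 2) * I.numVars =
      I.numVars + (I.numVars + (a * (2 * I.numVars) + w)) + 4 := by ring
  rw [code, h]
  simp only [List.getD_cons_succ]
  rw [List.getD_append_right _ _ _ _ (by simp), List.length_ofFn, Nat.add_sub_cancel_left,
    List.getD_append_right _ _ _ _ (by simp), List.length_ofFn, Nat.add_sub_cancel_left,
    getD_flatMap _ (2 * I.numVars) (by intro a; simp; ring) _ _ (by simp) _ hw]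
  simp

theorem preEntry_code (a : Fin (I.numActs + 2)) (v : Fin I.numVars) :
    preEntry I.code I.numVars a v = valCode (I.plan.extend.pre a v) := by
  refine Fin.cases ?_ (fun a => Fin.cases ?_ (fun a => ?_) a) a
  · exact Eq.trans (by simp [preEntry]) (I.code_entry_init v)
  · exact Eq.trans (by simp [preEntry]) (I.code_entry_goal v)
  · have h := I.code_entry_action a v (by omega)
    rw [List.getD_append _ _ _ _ (by simp), getD_ofFn] at h
    have h2 : (a.succ.succ : ℕ) + (a.succ.succ - 2) = 2 * a + 2 := by simp; omega
    rw [preEntry, h2, h]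
    rfl

theorem effEntry_code (a : Fin (I.numActs + 2)) (v : Fin I.numVars) :
    effEntry I.code I.numVars a v = valCode (I.plan.extend.eff a v) := by
  refine Fin.cases ?_ (fun a => Fin.cases ?_ (fun a => ?_) a) a
  · exact Eq.trans (by simp [effEntry]) (I.code_entry_init v)
  · exact Eq.trans (by simp [effEntry]) (I.code_entry_goal v)
  · have h := I.code_entry_action a (I.numVars + v) (by omega)
    rw [List.getD_append_right _ _ _ _ (by simp), List.length_ofFn, Nat.add_sub_cancel_left,
      getD_ofFn] at h
    have h2 : (a.succ.succ : ℕ) + (a.succ.succ - 1) = 2 * a + 3 := by simp; omega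
    have h3 : 4 + (v : ℕ) + (2 * a + 3) * I.numVars =
      4 + (I.numVars + v) + (2 * a + 2) * I.numVars := by ring
    rw [effEntry, h2, h3, h]
    rfl

/-- The formula to which an instance is reduced. -/
def formula : TwoNormalized :=
  planFormula (I.k + 2) I.numVars (I.numActs + 2) (preEntry I.code I.numVars)
    (effEntry I.code I.numVars)

/-- Both sides follow the same recursion. They agree from time `1` on because the action `0` sets
every variable, so the default `0` of `lastValue` never survives. -/
theorem lastValue_eq (α : ℕ → Fin (I.numActs + 2)) (h0 : α 0 = 0) (v : Fin I.numVars) (i : ℕ) :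
    lastValue (fun j => effEntry I.code I.numVars (α j) v) (i + 1) =
      valCode (some (I.plan.extend.states α (i + 1) v)) := by
  have hstep : ∀ (a : Fin (I.numActs + 2)) (s : Fin I.numVars → Fin I.numVals),
      valCode (some (I.plan.extend.result a s v)) =
        if 1 ≤ effEntry I.code I.numVars a v then effEntry I.code I.numVars a v
        else valCode (some (s v)) := by
    intro a s
    rw [effEntry_code, SASInstance.result]
    cases I.plan.extend.eff a v <;> simp [valCode]
  induction i with
  | zero =>
    rw [lastValue, SASInstance.states, hstep, h0]
    have h1 : 1 ≤ effEntry I.code I.numVars ((0 : Fin (I.numActs + 2)) : ℕ) v := by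
      rw [effEntry_code]
      exact Nat.succ_le_succ (Nat.zero_le _)
    rw [if_pos h1, if_pos h1]
  | succ i ih => rw [lastValue, SASInstance.states, hstep, ih]

theorem supported_iff_valid (α : ℕ → Fin (I.numActs + 2)) (h0 : α 0 = 0) :
    Supported (I.k + 2) I.numVars (preEntry I.code I.numVars) (effEntry I.code I.numVars)
        (fun i => α i) ↔
      ∀ i < (I.k : ℕ) + 2, I.plan.extend.Valid (α i) (I.plan.extend.states α i) := by
  have hE : ∀ v < I.numVars, 1 ≤ effEntry I.code I.numVars (α 0) v := by
    intro v hv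
    rw [h0, effEntry_code I 0 ⟨v, hv⟩]
    exact Nat.succ_le_succ (Nat.zero_le _)
  have hvalid : ∀ (a : Fin (I.numActs + 2)) (s : Fin I.numVars → Fin I.numVals),
      I.plan.extend.Valid a s ↔ ∀ v : Fin I.numVars, 1 ≤ preEntry I.code I.numVars a v →
        valCode (some (s v)) = preEntry I.code I.numVars a v := by
    intro a s
    refine forall_congr' fun v => ?_
    rw [preEntry_code, valCode_injective.eq_iff]
    cases I.plan.extend.pre a v <;> simp [valCode, eq_comm]
  rw [supported_iff hE]
  constructor
  · intro h i hi
    cases i with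
    | zero => rw [h0]; exact fun v => .inl rfl
    | succ i =>
      rw [hvalid]
      intro v hP
      rw [← lastValue_eq I α h0]
      exact h i hi v v.2 hP
  · intro h i hi v hv hP
    have := (hvalid _ _).1 (h (i + 1) hi) ⟨v, hv⟩ hP
    rwa [← lastValue_eq I α h0] at this

theorem exists_plan_iff_satisfiable :
    (∃ p : List (Fin I.numActs), p.length ≤ (I.k : ℕ) ∧ I.plan.IsPlan p) ↔
      ∃ S ⊆ vars I.formula, S.card = (I.k : ℕ) + 2 ∧ Holds I.formula S := by
  rw [SASInstance.exists_plan_iff, formula, satisfiable_planFormula (by omega) (by omega)]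
  constructor
  · rintro ⟨α, h0, h1, h⟩
    exact ⟨fun i => α i, fun i => (α i).2, by simp [h0], by simp [h1],
      (I.supported_iff_valid α h0).2 h⟩
  · rintro ⟨α, hα, h0, h1, h⟩
    have h0' : (⟨α 0, hα 0⟩ : Fin (I.numActs + 2)) = 0 := Fin.ext h0
    exact ⟨fun i => ⟨α i, hα i⟩, h0', Fin.ext h1,
      (I.supported_iff_valid (fun i => ⟨α i, hα i⟩) h0').1 h⟩

end BoundedSASInstance

theorem mainTheorem3 : boundedSASPlanning ∈ W2 := by
  refine ⟨fun I => (I.formula, I.k + 2), fun I => I.exists_plan_iff_satisfiable,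
    ⟨fun k => k + 2, (Primrec.nat_add.comp .id (.const 2)).to_comp, fun I => le_rfl⟩, ?_⟩
  obtain ⟨C, d, h⟩ := Cmd.exists_machine Cmd.reduction Cmd.reduction_ok
    Cmd.reduction_wellFormed
  -- The time is polynomial in the size alone, so the factor depending on the parameter is the
  -- constant `C`.
  refine ⟨⟨Cmd.reduction.toProg.machine .inp .res, Equiv.refl Bool, Equiv.refl Bool⟩,
    fun _ => C, d, Computable.const C, fun I => ?_⟩
  have hI := h (natsToWord I.code)
  have hden : (Cmd.reduction.den (fun _ => 0) ⟨[], natsToWord I.code, []⟩).out.reverse =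
      natsToWord (((I.k : ℕ) + 2) :: I.formula.code) := Cmd.reduction_den _ _ _ _ _
  rw [hden] at hI
  have hid : ∀ w : List Bool, w.map (Equiv.refl Bool).symm = w := fun w => List.map_id w
  let F : List Bool → List Bool → Prop := fun u w => Nonempty (Turing.TM2OutputsInTime
    (Cmd.reduction.toProg.machine .inp .res) u (some w) (C * ((natsToWord I.code).length + 1) ^ d))
  have hF : F ((natsToWord I.code).map (Equiv.refl Bool).symm)
      ((natsToWord (((I.k : ℕ) + 2) :: I.formula.code)).map (Equiv.refl Bool).symm) := by
    rw [hid, hid]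
    exact hI
  exact hF
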